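/- Let $X$ be a Euclidean space (a finite-dimensional real inner product space), let $A,B\subset X$ be closed and convex, and let $\bar x\in A\cap B$. Write $\mathbb B_\delta(\bar x)$ for the open ball, $d$ for distances, $N_A(a)$ for the Fréchet normal cone $\{v : \limsup_{a'\to a,\,a'\in A\setminus\{a\}}\langle v,a'-a\rangle/\|a'-a\|\le 0\}$. The pair $\{A,B\}$ is *subtransversal* at $\bar x$ if there are $\alpha\in(0,1)$, $\delta>0$ with $\alpha\, d(x,A\cap B)\le\max\{d(x,A),d(x,B)\}$ for all $x\in\mathbb B_\delta(\bar x)$. Let $\overline N:=\overline N_{A,B}(\bar x)$ be the set of pairs $(v_1,v_2)\in X\times X$ for which there are sequences $a_k\in A\setminus B$, $b_k\in B\setminus A$, $x_k\in X$, all converging to $\bar x$, with $x_k\ne a_k$, $x_k\ne b_k$, and $v_{1k}\in N_A(a_k)$, $v_{2k}\in N_B(b_k)$, such that $v_{1k}\to v_1$, $v_{2k}\to v_2$, $\frac{\|x_k-a_k\|}{\|x_k-b_k\|}\to1$, $\frac{\langle v_{1k},x_k-a_k\rangle}{\|v_{1k}\|\|x_k-a_k\|}\to1$, $\frac{\langle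 v_{2k},x_k-b_k\rangle}{\|v_{2k}\|\|x_k-b_k\|}\to1$ (with $0/0:=1$). Define - $\mathrm{itr}:=\liminf\|v_1+v_2\|$ over $a\to\bar x$, $b\to\bar x$, $x\to\bar x$, $a\in A\setminus B$, $b\in B\setminus A$, $x\ne a$, $x\neq b$, $v_1\in N_A(a)\setminus\{0\}$, $v_2\in N_B(b)\setminus\{0\}$, $\|v_1\|+\|v_2\|=1$, $\frac{\|x-a\|}{\|x-b\|}\to1$, $\frac{\langle v_1,x-a\rangle}{\|v_1\|\|x-a\|}\to1$, $\frac{\langle v_2,x-b\rangle}{\|v_2\|\|x-b\|}\to1$ (infimum over $\emptyset$ is $1$); - $\mathrm{itr}_1:=\max\|v_1-v_2\|$ and $\mathrm{itr}_2:=-\min\langle v_1,v_2\rangle$ over $(v_1,v_2)\in\overline N$ with $\|v_1\|=\|v_2\|=1$ (over $\emptyset$, the maximum is $0$ and the minimum is $1$); - $\mathrm{itr}_3:=\min_{\|v\|=1}d((v,-v),\overline N)$ with the Euclidean distance in $X\times X$ (the distance to $\emptyset$ is the distance to the origin, $\sqrt2$; if $X=\{0\}$, $\mathrm{itr}_3:=\sqrt2$);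 - $\widehat{\mathrm{itr}}_1:=\liminf\max\{d(\frac{b-a}{\|b-a\|},N_A(a)),d(\frac{a-b}{\|a-b\|},N_B(b))\}$ over $a\to\bar x$, $b\to\bar x$, $a\in A\setminus B$, $b\in B\setminus A$ (infimum over $\emptyset$ is $1$); - $\widehat{\mathrm{itr}}_2:=\limsup\big[\min\{\langle\frac{b-a}{\|b-a\|},v_1\rangle,\langle\frac{a-b}{\|a-b\|},v_2\rangle\}\big]_+$ over the same $a,b$ and $v_1\in N_A(a)$, $v_2\in N_B(b)$, $\|v_1\|=\|v_2\|=1$ (supremum over $\emptyset$ is $0$). **Theorem.** The following are equivalent: 1. $\{A,B\}$ is subtransversal at $\bar x$; 2. there is $\alpha\in(0,1)$ with $\|v_1+v_2\|>\alpha$ for all $(v_1,v_2)\in\overline N$ with $\|v_1\|=\|v_2\|=1$; 3. $\mathrm{itr}_1<2$; equivalently, there is $\alpha<2$ with $\|v_1-v_2\|<\alpha$ for all $(v_1,v_2)\in\overline N$ with $\|v_1\|=\|v_2\|=1$; 4. $\mathrm{itr}_2<1$; equivalently, there is $\alpha<1$ with $\langle v_1,v_2\rangle>-\alpha$ for all such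 pairs; 5. $\mathrm{itr}_3>0$; equivalently, there is $\alpha\in(0,1)$ with $d((v,-v),\overline N)>\alpha$ for all $v\in X$ with $\|v\|=1$; 6. $\widehat{\mathrm{itr}}_1>0$; equivalently, there are $\alpha\in(0,1)$, $\delta>0$ with $\max\{d(\frac{b-a}{\|b-a\|},N_A(a)),d(\frac{a-b}{\|a-b\|},N_B(b))\}>\alpha$ for all $a\in(A\setminus B)\cap\mathbb B_\delta(\bar x)$, $b\in(B\setminus A)\cap\mathbb B_\delta(\bar x)$; equivalently, there are $\alpha\in(0,1)$, $\delta>0$ with $\max\{\|\frac{b-a}{\|b-a\|}-v_1\|,\|\frac{a-b}{\|a-b\|}-v_2\|\}>\alpha$ for all such $a,b$ and all $v_1\in N_A(a)$, $v_2\in N_B(b)$; 7. $\widehat{\mathrm{itr}}_2<1$; equivalently, there are $\alpha\in(0,1)$, $\delta>0$ with $\min\{\langle\frac{b-a}{\|b-a\|},v_1\rangle,\langle\frac{a-b}{\|a-b\|},v_2\rangle\}<\alpha$ for all $a\in(A\setminus B)\cap\mathbb B_\delta(\bar x)$, $b\in(B\setminus A)\cap\mathbb B_\delta(\bar x)$ and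 all $v_1\in N_A(a)$, $v_2\in N_B(b)$ with $\|v_1\|=\|v_2\|=1$. Moreover, if these conditions hold, then $2\,\mathrm{itr}$ is the supremum of all $\alpha\in(0,2)$ satisfying the inequality in 2; $\mathrm{itr}_1$ is the infimum of all $\alpha\in(0,2)$ satisfying the inequality in 3; $\mathrm{itr}_2$ is the infimum of all $\alpha\in(-1,1)$ satisfying the inequality in 4; $\mathrm{itr}_3$ is the supremum of all $\alpha\in(0,\sqrt2)$ satisfying the inequality in 5; $\widehat{\mathrm{itr}}_1$ is the supremum of all $\alpha\in(0,1)$ satisfying (for some $\delta>0$) either of the inequalities in 6; and $\widehat{\mathrm{itr}}_2$ is the infimum of all $\alpha\in(0,1)$ satisfying (for some $\delta>0$) the inequality in 7. -/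

import Mathlib

open Filter Topology

noncomputable section

namespace SetPair

variable {E : Type*} [NormedAddCommGroup E] [InnerProductSpace ℝ E]

/-- `{A, B}` is subtransversal at `p`: for some `α ∈ (0, 1)` and `δ > 0`,
`α * d(x, A ∩ B) ≤ max (d(x, A)) (d(x, B))` on the open ball of radius `δ` around `p`. -/
def IsSubtransversal (A B : Set E) (p : E) : Prop :=
  ∃ α ∈ Set.Ioo (0 : ℝ) 1, ∃ δ > 0, ∀ x ∈ Metric.ball p δ,
    α * Metric.infDist x (A ∩ B) ≤ max (Metric.infDist x A) (Metric.infDist x B)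

/-- The Fréchet normal cone to `A` at `p ∈ A` (the dual space is identified with `E`): the
vectors `v` such that the upper limit of `⟪v, a - p⟫ / ‖a - p‖`, as `a → p` in `A \ {p}`, is
at most `0`. -/
def frechetNormalCone (A : Set E) (p : E) : Set E :=
  {v | ∀ ε > 0, ∀ᶠ a in 𝓝[A] p, inner ℝ v (a - p) ≤ ε * ‖a - p‖}

open Classical in
/-- The quotient `⟪v, w⟫ / (‖v‖ ‖w‖)` with the convention `0 / 0 = 1`. -/
def cosine (v w : E) : ℝ :=
  if v = 0 ∨ w = 0 then 1 else inner ℝ v w / (‖v‖ * ‖w‖)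

/-- The set of pairs of relative limiting normals to `{A, B}` at `p`. -/
def relLimitingNormals (A B : Set E) (p : E) : Set (E × E) :=
  {w | ∃ a b x v₁ v₂ : ℕ → E,
    (∀ k, a k ∈ A \ B) ∧ (∀ k, b k ∈ B \ A) ∧ (∀ k, x k ≠ a k) ∧ (∀ k, x k ≠ b k) ∧
    Tendsto a atTop (𝓝 p) ∧ Tendsto b atTop (𝓝 p) ∧ Tendsto x atTop (𝓝 p) ∧
    Tendsto v₁ atTop (𝓝 w.1) ∧ Tendsto v₂ atTop (𝓝 w.2) ∧
    (∀ k, v₁ k ∈ frechetNormalCone A (a k)) ∧ (∀ k, v₂ k ∈ frechetNormalCone B (b k)) ∧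
    Tendsto (fun k => ‖x k - a k‖ / ‖x k - b k‖) atTop (𝓝 1) ∧
    Tendsto (fun k => cosine (v₁ k) (x k - a k)) atTop (𝓝 1) ∧
    Tendsto (fun k => cosine (v₂ k) (x k - b k)) atTop (𝓝 1)}

open Classical in
/-- The infimum of a set of reals, with the value `c` for the empty set. -/
def infOr (c : ℝ) (S : Set ℝ) : ℝ := if S = ∅ then c else sInf S

open Classical in
/-- The supremum of a set of reals, with the value `c` for the empty set. -/
def supOr (c : ℝ) (S : Set ℝ) : ℝ := if S = ∅ then c else sSup S

/-- The values `‖v₁ + v₂‖` that enter the lower limit defining `itr` at scale `ρ`. -/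
def itrValues (A B : Set E) (p : E) (ρ : ℝ) : Set ℝ :=
  {r | ∃ a ∈ (A \ B) ∩ Metric.ball p ρ, ∃ b ∈ (B \ A) ∩ Metric.ball p ρ,
    ∃ x ∈ Metric.ball p ρ, x ≠ a ∧ x ≠ b ∧
    ∃ v₁ ∈ frechetNormalCone A a, ∃ v₂ ∈ frechetNormalCone B b,
      v₁ ≠ 0 ∧ v₂ ≠ 0 ∧ ‖v₁‖ + ‖v₂‖ = 1 ∧
      ‖x - a‖ / ‖x - b‖ ∈ Set.Ioo (1 - ρ) (1 + ρ) ∧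
      1 - ρ < cosine v₁ (x - a) ∧ 1 - ρ < cosine v₂ (x - b) ∧ r = ‖v₁ + v₂‖}

/-- The intrinsic transversality constant `itr[A, B](p)`, a lower limit, i.e. the limit as
`ρ ↓ 0` (equivalently, the supremum over `ρ > 0`) of infima, where the infimum of the empty
set is `1`. -/
def itr (A B : Set E) (p : E) : ℝ :=
  sSup ((fun ρ => infOr 1 (itrValues A B p ρ)) '' Set.Ioi 0)

/-- The pairs of relative limiting normals both members of which are unit vectors. -/
def unitRelLimitingNormals (A B : Set E) (p : E) : Set (E × E) :=
  {w | w ∈ relLimitingNormals A B p ∧ ‖w.1‖ = 1 ∧ ‖w.2‖ = 1}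

/-- `itr₁`: the maximum of `‖v₁ - v₂‖` over unit pairs of relative limiting normals
(`0` if there are none). -/
def itr₁ (A B : Set E) (p : E) : ℝ :=
  supOr 0 ((fun w : E × E => ‖w.1 - w.2‖) '' unitRelLimitingNormals A B p)

/-- `itr₂`: minus the minimum of `⟪v₁, v₂⟫` over unit pairs of relative limiting normals
(the minimum is `1` if there are none). -/
def itr₂ (A B : Set E) (p : E) : ℝ :=
  -infOr 1 ((fun w : E × E => (inner ℝ w.1 w.2 : ℝ)) '' unitRelLimitingNormals A B p)

open Classical in
/-- The distance, for the Euclidean norm of `E × E`, from `w` to a set `N`, where the distance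
to the empty set is the distance to the origin. -/
def pairDist (w : E × E) (N : Set (E × E)) : ℝ :=
  if N = ∅ then ‖WithLp.toLp 2 w‖ else Metric.infDist (WithLp.toLp 2 w) (WithLp.toLp 2 '' N)

/-- `itr₃`: the minimum over unit vectors `v` of the distance from `(v, -v)` to the set of pairs
of relative limiting normals. If `E` is trivial, there are neither unit vectors nor relative
limiting normals, and the value is `√2`, as always when there are no relative limiting normals. -/
def itr₃ (A B : Set E) (p : E) : ℝ :=
  infOr (√2) ((fun v : E => pairDist (v, -v) (relLimitingNormals A B p)) '' Metric.sphere 0 1)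

/-- The unit vector pointing from `a` to `b` (for `a ≠ b`). -/
def dir (a b : E) : E := ‖b - a‖⁻¹ • (b - a)

/-- `îtr₁`: the lower limit, as `a → p` in `A \ B` and `b → p` in `B \ A`, of the larger of the
distances from `(b - a) / ‖b - a‖` to the normal cone `N_A(a)` and from `(a - b) / ‖a - b‖` to
`N_B(b)`; infima over the empty set are `1`. -/
def itrHat₁ (A B : Set E) (p : E) : ℝ :=
  sSup ((fun ρ => infOr 1 {r | ∃ a ∈ (A \ B) ∩ Metric.ball p ρ, ∃ b ∈ (B \ A) ∩ Metric.ball p ρ,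
    r = max (Metric.infDist (dir a b) (frechetNormalCone A a))
      (Metric.infDist (dir b a) (frechetNormalCone B b))}) '' Set.Ioi 0)

/-- `îtr₂`: the upper limit, as `a → p` in `A \ B` and `b → p` in `B \ A`, and over unit
Fréchet normals `v₁` to `A` at `a` and `v₂` to `B` at `b`, of the positive part of
`min ⟪(b - a) / ‖b - a‖, v₁⟫ ⟪(a - b) / ‖a - b‖, v₂⟫`; suprema over the empty set are `0`. -/
def itrHat₂ (A B : Set E) (p : E) : ℝ :=
  sInf ((fun ρ => supOr 0 {r | ∃ a ∈ (A \ B) ∩ Metric.ball p ρ, ∃ b ∈ (B \ A) ∩ Metric.ball p ρ,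
    ∃ v₁ ∈ frechetNormalCone A a, ∃ v₂ ∈ frechetNormalCone B b, ‖v₁‖ = 1 ∧ ‖v₂‖ = 1 ∧
      r = max (min (inner ℝ (dir a b) v₁) (inner ℝ (dir b a) v₂)) 0}) '' Set.Ioi 0)

/-- Near `p`, the larger of the distances of the directions between `a ∈ A \ B` and `b ∈ B \ A`
to the normal cones exceeds `α`. -/
def HatDistGt (A B : Set E) (p : E) (α : ℝ) : Prop :=
  ∃ δ > 0, ∀ a ∈ (A \ B) ∩ Metric.ball p δ, ∀ b ∈ (B \ A) ∩ Metric.ball p δ,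
    α < max (Metric.infDist (dir a b) (frechetNormalCone A a))
      (Metric.infDist (dir b a) (frechetNormalCone B b))

/-- The same with the distances to all individual normals. -/
def HatNormGt (A B : Set E) (p : E) (α : ℝ) : Prop :=
  ∃ δ > 0, ∀ a ∈ (A \ B) ∩ Metric.ball p δ, ∀ b ∈ (B \ A) ∩ Metric.ball p δ,
    ∀ v₁ ∈ frechetNormalCone A a, ∀ v₂ ∈ frechetNormalCone B b,
      α < max ‖dir a b - v₁‖ ‖dir b a - v₂‖

/-- Near `p`, for all unit normals `v₁, v₂` at `a ∈ A \ B` and `b ∈ B \ A`, the smaller of the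
cosines of their angles with the directions between `a` and `b` is less than `α`. -/
def HatInnerLt (A B : Set E) (p : E) (α : ℝ) : Prop :=
  ∃ δ > 0, ∀ a ∈ (A \ B) ∩ Metric.ball p δ, ∀ b ∈ (B \ A) ∩ Metric.ball p δ,
    ∀ v₁ ∈ frechetNormalCone A a, ∀ v₂ ∈ frechetNormalCone B b, ‖v₁‖ = 1 → ‖v₂‖ = 1 →
      min (inner ℝ (dir a b) v₁) (inner ℝ (dir b a) v₂) < α

end SetPair

end

/-!
For a convex set, Fréchet normals are normals in the sense of convex analysis, and every condition
of the theorem turns out to say that there is no *antipodal* unit pair `(u, -u)` of relative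
limiting normals.

The set of relative limiting normals is an intersection of closures of sets of approximate normals
(`relLimitingNormals_eq_iInter`), hence closed, and its unit pairs form a compact set. Extrema over
that set are attained, so for unit vectors the identities `‖u ± v‖ ^ 2 = 2 ± 2 * ⟪u, v⟫` translate
the conditions on `‖v₁ + v₂‖`, `‖v₁ - v₂‖`, `⟪v₁, v₂⟫` and the distance from `(v, -v)` into each
other.

The conditions on the directions between `a ∈ A \ B` and `b ∈ B \ A` are linked to antipodal pairs
by choosing the midpoint of `a` and `b` for the auxiliary point `x`
(`exists_hatInnerLt_of_forall_norm_add`), and conversely by the observation that, for an antipodal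
limit, `x` is asymptotically the midpoint (`HatNormGt.norm_add_ne_zero`).

Subtransversality fails if the directions between `a` and `b` are nearly normal: a point of `A ∩ B`
lies in both supporting half-spaces, which are nearly opposite to each other, so it is far away
compared with `‖b - a‖` (`IsSubtransversal.exists_hatNormGt`). Conversely, Ekeland's variational
principle applied to `(a, b) ↦ ‖a - b‖` on `A × B` turns a failure of subtransversality into points
`a`, `b` between which the directions are nearly normal (`HatDistGt.isSubtransversal`); first-order
optimality yields approximate normality through Moreau's decomposition
(`infDist_frechetNormalCone_le`).

The quantitative part is bookkeeping with lower and upper limits, except for the factor `2` in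
front of `itr`: among the combinations of two unit vectors with nonnegative weights of sum `1`, the
midpoint is the shortest (`norm_normalize_add_normalize_le`).
-/

namespace SetPair

variable {E : Type*} [NormedAddCommGroup E] [InnerProductSpace ℝ E] {A B : Set E} {p : E}

/-! ### Normal cones of convex sets -/

/-- For a convex set the Fréchet normal cone is the normal cone of convex analysis: moving from `a`
towards `z` inside the set turns the local upper bound into a global one. -/
theorem mem_frechetNormalCone_iff (hA : Convex ℝ A) {a v : E} (ha : a ∈ A) :
    v ∈ frechetNormalCone A a ↔ ∀ z ∈ A, inner ℝ v (z - a) ≤ 0 := by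
  refine ⟨fun hv z hz => ?_, fun h ε hε => ?_⟩
  · have key : ∀ ε > 0, inner ℝ v (z - a) ≤ ε * ‖z - a‖ := by
      intro ε hε
      have hmem : ∀ᶠ t : ℝ in 𝓝[>] 0, t ∈ Set.Ioo (0 : ℝ) 1 :=
        Ioo_mem_nhdsGT one_pos
      have ht : Tendsto (fun t : ℝ => a + t • (z - a)) (𝓝[>] 0) (𝓝[A] a) := by
        refine tendsto_nhdsWithin_iff.2 ⟨?_, hmem.mono fun t ht => ?_⟩
        · have hc : Continuous fun t : ℝ => a + t • (z - a) := by fun_prop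
          have := (hc.tendsto 0).mono_left (nhdsWithin_le_nhds (s := Set.Ioi (0 : ℝ)))
          simpa using this
        · exact hA.add_smul_sub_mem ha hz ⟨ht.1.le, ht.2.le⟩
      obtain ⟨t, h1, h2⟩ := ((ht.eventually (hv ε hε)).and hmem).exists
      rw [add_sub_cancel_left, inner_smul_right, norm_smul, Real.norm_of_nonneg h2.1.le] at h1
      nlinarith [h2.1]
    refine le_of_forall_pos_le_add fun η hη => ?_
    have hn : 0 < ‖z - a‖ + 1 := by positivity
    refine (key (η / (‖z - a‖ + 1)) (by positivity)).trans ?_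
    rw [div_mul_eq_mul_div, div_le_iff₀ hn]
    nlinarith [norm_nonneg (z - a)]
  · filter_upwards [self_mem_nhdsWithin] with z hz
    exact (h z hz).trans (by positivity)

theorem zero_mem_frechetNormalCone (A : Set E) (a : E) : (0 : E) ∈ frechetNormalCone A a := by
  intro ε hε
  refine Eventually.of_forall fun z => ?_
  rw [inner_zero_left]
  positivity

theorem smul_mem_frechetNormalCone {a v : E} (hv : v ∈ frechetNormalCone A a) {t : ℝ}
    (ht : 0 < t) : t • v ∈ frechetNormalCone A a := by
  intro ε hε
  filter_upwards [hv (ε / t) (by positivity)] with z hz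
  rw [real_inner_smul_left]
  calc t * inner ℝ v (z - a) ≤ t * (ε / t * ‖z - a‖) := by gcongr
    _ = ε * ‖z - a‖ := by field_simp

theorem isClosed_frechetNormalCone (hA : Convex ℝ A) {a : E} (ha : a ∈ A) :
    IsClosed (frechetNormalCone A a) := by
  have : frechetNormalCone A a = ⋂ z ∈ A, {v | inner ℝ v (z - a) ≤ 0} := by
    ext v
    simp [mem_frechetNormalCone_iff hA ha]
  rw [this]
  exact isClosed_biInter fun z _ => isClosed_le (by fun_prop) continuous_const

/-- If `⟪u, ·⟫` grows at rate at most `ε` from `a` into the convex set `A`, then `u` is within `ε`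
of the normal cone. By Moreau's decomposition, `u` minus its projection `q` onto the closed cone
generated by `A - a` is normal, and `‖q‖ ^ 2 = ⟪u, q⟫ ≤ ε * ‖q‖`. -/
theorem infDist_frechetNormalCone_le [FiniteDimensional ℝ E] (hA : Convex ℝ A) {a u : E}
    (ha : a ∈ A) {ε : ℝ} (hε : 0 ≤ ε) (h : ∀ z ∈ A, inner ℝ u (z - a) ≤ ε * ‖z - a‖) :
    Metric.infDist u (frechetNormalCone A a) ≤ ε := by
  set C : Set E := {k | ∃ t : ℝ, 0 ≤ t ∧ ∃ z ∈ A, k = t • (z - a)} with hC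
  have hCconv : Convex ℝ C := by
    rintro _ ⟨s, hs, y, hy, rfl⟩ _ ⟨t, ht, z, hz, rfl⟩ c d hc hd hcd
    rcases (show 0 ≤ c * s + d * t by positivity).eq_or_lt with h0 | h0
    · have h1 : c * s = 0 := by nlinarith [mul_nonneg hc hs, mul_nonneg hd ht]
      have h2 : d * t = 0 := by nlinarith [mul_nonneg hc hs, mul_nonneg hd ht]
      exact ⟨0, le_rfl, a, ha, by simp [smul_smul, h1, h2]⟩
    · refine ⟨c * s + d * t, h0.le, (c * s / (c * s + d * t)) • y + (d * t / (c * s + d * t)) • z,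
        hA hy hz (by positivity) (by positivity) (by field_simp), ?_⟩
      rw [smul_sub (c * s + d * t), smul_add, smul_smul (c * s + d * t), smul_smul (c * s + d * t),
        mul_div_cancel₀ _ h0.ne', mul_div_cancel₀ _ h0.ne']
      module
  have hne : (closure C).Nonempty := ⟨0, subset_closure ⟨0, le_rfl, a, ha, by simp⟩⟩
  obtain ⟨q, hq, hmin⟩ := exists_norm_eq_iInf_of_complete_convex hne
    isClosed_closure.isComplete hCconv.closure u
  rw [norm_eq_iInf_iff_real_inner_le_zero hCconv.closure hq] at hmin
  have hpol : ∀ k ∈ C, inner ℝ (u - q) k ≤ 0 := by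
    rintro _ ⟨t, ht, z, hz, rfl⟩
    by_contra! hpos
    -- As `C` is a cone, minimality can be tested against `s • k` with `s` so large that it fails.
    have hscale : ∀ s : ℝ, 0 ≤ s → s * inner ℝ (u - q) (t • (z - a)) ≤ inner ℝ (u - q) q := by
      intro s hs
      have := hmin (s • t • (z - a)) (subset_closure ⟨s * t, by positivity, z, hz, by
        rw [smul_smul]⟩)
      rw [inner_sub_right, inner_smul_right] at this
      linarith
    have h0 := hscale 0 le_rfl
    have h1 := hscale ((inner ℝ (u - q) q + 1) / inner ℝ (u - q) (t • (z - a)))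
      (div_nonneg (by linarith) hpos.le)
    rw [div_mul_cancel₀ _ hpos.ne'] at h1
    linarith
  have hnorm : u - q ∈ frechetNormalCone A a := (mem_frechetNormalCone_iff hA ha).2 fun z hz =>
    hpol _ ⟨1, zero_le_one, z, hz, by simp⟩
  have hqq : inner ℝ (u - q) q = 0 := by
    refine le_antisymm ?_ ?_
    · exact closure_minimal (s := C) (t := {k | inner ℝ (u - q) k ≤ 0}) hpol
        (isClosed_le (by fun_prop) continuous_const) hq
    · have := hmin 0 (subset_closure ⟨0, le_rfl, a, ha, by simp⟩)
      rw [zero_sub, inner_neg_right] at this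
      linarith
  have huq : inner ℝ u q ≤ ε * ‖q‖ := by
    refine closure_minimal (s := C) (t := {k | inner ℝ u k ≤ ε * ‖k‖}) ?_
      (isClosed_le (by fun_prop) (by fun_prop)) hq
    rintro _ ⟨t, ht, z, hz, rfl⟩
    rw [Set.mem_ofPred_eq, inner_smul_right, norm_smul, Real.norm_of_nonneg ht]
    nlinarith [h z hz]
  rw [inner_sub_left, real_inner_self_eq_norm_sq] at hqq
  have hle : ‖q‖ ≤ ε := by
    by_contra! hlt
    nlinarith [norm_nonneg q]
  refine (Metric.infDist_le_dist_of_mem hnorm).trans ?_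
  rwa [dist_eq_norm, sub_sub_cancel]

/-! ### Directions and cosines -/

theorem norm_inv_norm_smul {v : E} (hv : v ≠ 0) : ‖‖v‖⁻¹ • v‖ = 1 := by
  rw [norm_smul, norm_inv, norm_norm, inv_mul_cancel₀ (norm_ne_zero_iff.2 hv)]

theorem dir_swap (a b : E) : dir b a = -dir a b := by
  rw [dir, dir, ← smul_neg, neg_sub, norm_sub_rev]

theorem norm_dir {a b : E} (h : a ≠ b) : ‖dir a b‖ = 1 := by
  rw [dir]
  exact norm_inv_norm_smul (sub_ne_zero.2 h.symm)

theorem norm_dir_le (a b : E) : ‖dir a b‖ ≤ 1 := by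
  by_cases h : a = b
  · simp [dir, h]
  · exact (norm_dir h).le

theorem norm_sub_sq_of_unit {u v : E} (hu : ‖u‖ = 1) (hv : ‖v‖ = 1) :
    ‖u - v‖ ^ 2 = 2 - 2 * inner ℝ u v := by
  rw [norm_sub_sq_real, hu, hv]
  ring

theorem norm_add_sq_of_unit {u v : E} (hu : ‖u‖ = 1) (hv : ‖v‖ = 1) :
    ‖u + v‖ ^ 2 = 2 + 2 * inner ℝ u v := by
  rw [norm_add_sq_real, hu, hv]
  ring

theorem cosine_eq {v w : E} (hv : v ≠ 0) (hw : w ≠ 0) :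
    cosine v w = inner ℝ (‖v‖⁻¹ • v) (‖w‖⁻¹ • w) := by
  rw [cosine, if_neg (by tauto), real_inner_smul_left, inner_smul_right]
  field_simp

theorem cosine_le_one (v w : E) : cosine v w ≤ 1 := by
  rw [cosine]
  split_ifs
  · exact le_rfl
  · exact (abs_le.1 (abs_real_inner_div_norm_mul_norm_le_one v w)).2

theorem cosine_smul_left {t : ℝ} (ht : 0 < t) (v w : E) : cosine (t • v) w = cosine v w := by
  by_cases h : v = 0 ∨ w = 0
  · have h' : t • v = 0 ∨ w = 0 := h.imp_left fun h => by simp [h]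
    rw [cosine, cosine, if_pos h, if_pos h']
  · have h' : ¬ (t • v = 0 ∨ w = 0) := by simpa [ht.ne'] using h
    rw [cosine, cosine, if_neg h, if_neg h', real_inner_smul_left, norm_smul,
      Real.norm_of_nonneg ht.le, mul_assoc, mul_div_mul_left _ _ ht.ne']

/-- The vector from `a` to the midpoint of `a` and `b` has the direction `dir a b`. -/
theorem cosine_midpoint_sub_left {a b v : E} (hab : a ≠ b) (hv : ‖v‖ = 1) :
    cosine v (midpoint ℝ a b - a) = inner ℝ (dir a b) v := by
  have h : midpoint ℝ a b - a = (1 / 2 : ℝ) • (b - a) := by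
    rw [midpoint_sub_left, invOf_eq_inv, one_div]
  have hba : b - a ≠ 0 := sub_ne_zero.2 hab.symm
  have hv0 : v ≠ 0 := by rintro rfl; simp at hv
  rw [h, cosine_eq hv0 (by simpa using hba), dir, real_inner_comm, hv, norm_smul, smul_smul]
  have hhalf : (‖(1 / 2 : ℝ)‖ * ‖b - a‖)⁻¹ * (1 / 2) = ‖b - a‖⁻¹ := by
    rw [Real.norm_of_nonneg (by norm_num), mul_inv]
    ring
  rw [hhalf, inv_one, one_smul]

/-- Nonzero vectors whose angles with convergent vectors tend to `0` have convergent
directions. -/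
theorem tendsto_normalize_of_cosine {v z : ℕ → E} {u : E} (hu : ‖u‖ = 1)
    (hv : Tendsto v atTop (𝓝 u)) (hz : ∀ k, z k ≠ 0)
    (hc : Tendsto (fun k => cosine (v k) (z k)) atTop (𝓝 1)) :
    Tendsto (fun k => ‖z k‖⁻¹ • z k) atTop (𝓝 u) := by
  have hu0 : u ≠ 0 := by rintro rfl; simp at hu
  have hn : Tendsto (fun k => ‖v k‖⁻¹ • v k) atTop (𝓝 u) := by
    have := (hv.norm.inv₀ (by simpa using hu0)).smul hv
    simpa [hu] using this
  have hsq : Tendsto (fun k => ‖‖z k‖⁻¹ • z k - ‖v k‖⁻¹ • v k‖ ^ 2) atTop (𝓝 0) := by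
    have h2 : Tendsto (fun k => 2 - 2 * cosine (v k) (z k)) atTop (𝓝 0) := by
      simpa using (hc.const_mul 2).const_sub 2
    refine h2.congr' ?_
    filter_upwards [hv.eventually_ne hu0] with k hk
    rw [norm_sub_sq_of_unit (norm_inv_norm_smul (hz k))
      (norm_inv_norm_smul hk), real_inner_comm, cosine_eq hk (hz k)]
  have h0 : Tendsto (fun k => ‖‖z k‖⁻¹ • z k - ‖v k‖⁻¹ • v k‖) atTop (𝓝 0) := by
    simpa using hsq.sqrt
  simpa using (tendsto_zero_iff_norm_tendsto_zero.2 h0).add hn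

/-- Among the combinations `s • n₁ + t • n₂` of two unit vectors with weights `s + t = 1`, the
midpoint is the shortest. -/
theorem norm_normalize_add_normalize_le {v₁ v₂ : E} (h₁ : v₁ ≠ 0) (h₂ : v₂ ≠ 0)
    (h : ‖v₁‖ + ‖v₂‖ = 1) : ‖‖v₁‖⁻¹ • v₁ + ‖v₂‖⁻¹ • v₂‖ ≤ 2 * ‖v₁ + v₂‖ := by
  set n₁ := ‖v₁‖⁻¹ • v₁ with hn₁
  set n₂ := ‖v₂‖⁻¹ • v₂ with hn₂
  have hu₁ : ‖n₁‖ = 1 := norm_inv_norm_smul h₁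
  have hu₂ : ‖n₂‖ = 1 := norm_inv_norm_smul h₂
  have e₁ : v₁ = ‖v₁‖ • n₁ := by rw [hn₁, smul_inv_smul₀ (by simpa using h₁)]
  have e₂ : v₂ = ‖v₂‖ • n₂ := by rw [hn₂, smul_inv_smul₀ (by simpa using h₂)]
  have hsq : ‖v₁ + v₂‖ ^ 2 = ‖v₁‖ ^ 2 + 2 * (‖v₁‖ * ‖v₂‖ * inner ℝ n₁ n₂) + ‖v₂‖ ^ 2 := by
    rw [norm_add_sq_real]
    congr 3
    conv_lhs => rw [e₁, e₂]
    rw [real_inner_smul_left, inner_smul_right, mul_assoc]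
  have hc : inner ℝ n₁ n₂ ≤ 1 := by
    simpa [hu₁, hu₂] using real_inner_le_norm n₁ n₂
  refine abs_le_of_sq_le_sq' ?_ (by positivity) |>.2
  rw [norm_add_sq_of_unit hu₁ hu₂, mul_pow, hsq]
  have ht : ‖v₂‖ = 1 - ‖v₁‖ := by linarith
  rw [ht]
  nlinarith [mul_nonneg (sub_nonneg.2 hc) (sq_nonneg (2 * ‖v₁‖ - 1))]

/-! ### Relative limiting normals as limits of approximate ones -/

/-- The pairs of normals admitted at scale `ρ` in the definition of `itr`, without normalization. -/
def approxNormals (A B : Set E) (p : E) (ρ : ℝ) : Set (E × E) :=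
  {w | ∃ a ∈ (A \ B) ∩ Metric.ball p ρ, ∃ b ∈ (B \ A) ∩ Metric.ball p ρ,
    ∃ x ∈ Metric.ball p ρ, x ≠ a ∧ x ≠ b ∧
    w.1 ∈ frechetNormalCone A a ∧ w.2 ∈ frechetNormalCone B b ∧
    ‖x - a‖ / ‖x - b‖ ∈ Set.Ioo (1 - ρ) (1 + ρ) ∧
    1 - ρ < cosine w.1 (x - a) ∧ 1 - ρ < cosine w.2 (x - b)}

theorem approxNormals_mono {ρ σ : ℝ} (h : ρ ≤ σ) :
    approxNormals A B p ρ ⊆ approxNormals A B p σ := by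
  rintro w ⟨a, ha, b, hb, x, hx, hxa, hxb, h₁, h₂, hr, hc₁, hc₂⟩
  have hball := Metric.ball_subset_ball (x := p) h
  exact ⟨a, ⟨ha.1, hball ha.2⟩, b, ⟨hb.1, hball hb.2⟩, x, hball hx, hxa, hxb, h₁, h₂,
    ⟨by linarith [hr.1], by linarith [hr.2]⟩, by linarith, by linarith⟩

theorem smul_mem_approxNormals {ρ s t : ℝ} (hs : 0 < s) (ht : 0 < t) {w : E × E}
    (hw : w ∈ approxNormals A B p ρ) : (s • w.1, t • w.2) ∈ approxNormals A B p ρ := by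
  obtain ⟨a, ha, b, hb, x, hx, hxa, hxb, h₁, h₂, hr, hc₁, hc₂⟩ := hw
  refine ⟨a, ha, b, hb, x, hx, hxa, hxb, smul_mem_frechetNormalCone h₁ hs,
    smul_mem_frechetNormalCone h₂ ht, hr, ?_, ?_⟩
  · simpa only [cosine_smul_left hs] using hc₁
  · simpa only [cosine_smul_left ht] using hc₂

theorem relLimitingNormals_eq_iInter :
    relLimitingNormals A B p = ⋂ ρ ∈ Set.Ioi (0 : ℝ), closure (approxNormals A B p ρ) := by
  ext w
  simp only [Set.mem_iInter, Set.mem_Ioi]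
  constructor
  · rintro ⟨a, b, x, v₁, v₂, ha, hb, hxa, hxb, ta, tb, tx, t₁, t₂, h₁, h₂, tr, tc₁, tc₂⟩ ρ hρ
    refine mem_closure_of_tendsto (t₁.prodMk_nhds t₂) ?_
    filter_upwards [ta (Metric.ball_mem_nhds p hρ), tb (Metric.ball_mem_nhds p hρ),
      tx (Metric.ball_mem_nhds p hρ),
      tr (Ioo_mem_nhds (sub_lt_self 1 hρ) (lt_add_of_pos_right 1 hρ)),
      tc₁ (Ioi_mem_nhds (show 1 - ρ < 1 by linarith)),
      tc₂ (Ioi_mem_nhds (show 1 - ρ < 1 by linarith))] with k ka kb kx kr k₁ k₂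
    exact ⟨a k, ⟨ha k, ka⟩, b k, ⟨hb k, kb⟩, x k, kx, hxa k, hxb k, h₁ k, h₂ k, kr, k₁, k₂⟩
  · intro h
    have hpos : ∀ k : ℕ, (0 : ℝ) < 1 / ((k : ℝ) + 1) := fun k => by positivity
    have h' : ∀ k : ℕ, ∃ v ∈ approxNormals A B p (1 / ((k : ℝ) + 1)),
        dist w v < 1 / ((k : ℝ) + 1) := fun k => Metric.mem_closure_iff.1 (h _ (hpos k)) _ (hpos k)
    choose v hv hd using h'
    choose a ha b hb x hx hxa hxb h₁ h₂ hr hc₁ hc₂ using hv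
    have t0 := tendsto_one_div_add_atTop_nhds_zero_nat (𝕜 := ℝ)
    have tlo : Tendsto (fun k : ℕ => 1 - 1 / ((k : ℝ) + 1)) atTop (𝓝 1) := by
      simpa using t0.const_sub 1
    have thi : Tendsto (fun k : ℕ => 1 + 1 / ((k : ℝ) + 1)) atTop (𝓝 1) := by
      simpa using t0.const_add 1
    have conv : ∀ y : ℕ → E, (∀ k : ℕ, y k ∈ Metric.ball p (1 / ((k : ℝ) + 1))) →
        Tendsto y atTop (𝓝 p) := fun y hy => tendsto_iff_dist_tendsto_zero.2
      (squeeze_zero (fun _ => dist_nonneg) (fun k => (hy k).le) t0)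
    have tv : Tendsto v atTop (𝓝 w) := tendsto_iff_dist_tendsto_zero.2
      (squeeze_zero (fun _ => dist_nonneg) (fun k => by rw [dist_comm]; exact (hd k).le) t0)
    exact ⟨a, b, x, fun k => (v k).1, fun k => (v k).2, fun k => (ha k).1, fun k => (hb k).1,
      hxa, hxb, conv a fun k => (ha k).2, conv b fun k => (hb k).2, conv x hx,
      (continuous_fst.tendsto w).comp tv, (continuous_snd.tendsto w).comp tv, h₁, h₂,
      tendsto_of_tendsto_of_tendsto_of_le_of_le tlo thi (fun k => (hr k).1.le)
        (fun k => (hr k).2.le),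
      tendsto_of_tendsto_of_tendsto_of_le_of_le tlo tendsto_const_nhds (fun k => (hc₁ k).le)
        (fun k => cosine_le_one _ _),
      tendsto_of_tendsto_of_tendsto_of_le_of_le tlo tendsto_const_nhds (fun k => (hc₂ k).le)
        (fun k => cosine_le_one _ _)⟩

theorem isClosed_relLimitingNormals : IsClosed (relLimitingNormals A B p) := by
  rw [relLimitingNormals_eq_iInter]
  exact isClosed_biInter fun _ _ => isClosed_closure

theorem isCompact_unitRelLimitingNormals [FiniteDimensional ℝ E] :
    IsCompact (unitRelLimitingNormals A B p) := by
  have h : unitRelLimitingNormals A B p =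
      (Metric.sphere (0 : E) 1 ×ˢ Metric.sphere (0 : E) 1) ∩ relLimitingNormals A B p := by
    ext w
    simp only [unitRelLimitingNormals, Set.mem_ofPred_eq, Set.mem_inter_iff, Set.mem_prod,
      mem_sphere_zero_iff_norm]
    tauto
  rw [h]
  exact ((isCompact_sphere _ _).prod (isCompact_sphere _ _)).inter_right isClosed_relLimitingNormals

/-- Unit approximate normals at arbitrarily small scales accumulate at a unit pair of relative
limiting normals, and a bound on a continuous function passes to the limit. -/
theorem exists_unitRelLimitingNormals_le [FiniteDimensional ℝ E] {f : E × E → ℝ}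
    (hf : Continuous f) {c : ℝ}
    (h : ∀ ρ > 0, ∃ w ∈ approxNormals A B p ρ, ‖w.1‖ = 1 ∧ ‖w.2‖ = 1 ∧ f w ≤ c) :
    ∃ w ∈ unitRelLimitingNormals A B p, f w ≤ c := by
  have hpos : ∀ k : ℕ, (0 : ℝ) < 1 / ((k : ℝ) + 1) := fun k => by positivity
  choose v hv h₁ h₂ hc using fun k : ℕ => h _ (hpos k)
  obtain ⟨w, hw, φ, hφ, ht⟩ :=
    ((isCompact_sphere (0 : E) 1).prod (isCompact_sphere (0 : E) 1)).tendsto_subseq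
      (x := v) fun k => ⟨by simpa using h₁ k, by simpa using h₂ k⟩
  refine ⟨w, ⟨?_, by simpa using hw.1, by simpa using hw.2⟩,
    le_of_tendsto ((hf.tendsto w).comp ht) (Eventually.of_forall fun k => hc _)⟩
  rw [relLimitingNormals_eq_iInter]
  refine Set.mem_iInter₂.2 fun ρ hρ => mem_closure_of_tendsto ht ?_
  have t0 := (tendsto_one_div_add_atTop_nhds_zero_nat (𝕜 := ℝ)).comp hφ.tendsto_atTop
  filter_upwards [t0.eventually_lt_const hρ] with k hk
  exact approxNormals_mono hk.le (hv _)

/-! ### The three forms of the condition on directions -/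

theorem hatNormGt_iff_hatDistGt [FiniteDimensional ℝ E] (hA : Convex ℝ A) (hB : Convex ℝ B)
    {α : ℝ} : HatNormGt A B p α ↔ HatDistGt A B p α := by
  constructor
  · rintro ⟨δ, hδ, h⟩
    refine ⟨δ, hδ, fun a ha b hb => ?_⟩
    obtain ⟨v₁, hv₁, e₁⟩ := (isClosed_frechetNormalCone hA ha.1.1).exists_infDist_eq_dist
      ⟨0, zero_mem_frechetNormalCone A a⟩ (dir a b)
    obtain ⟨v₂, hv₂, e₂⟩ := (isClosed_frechetNormalCone hB hb.1.1).exists_infDist_eq_dist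
      ⟨0, zero_mem_frechetNormalCone B b⟩ (dir b a)
    rw [e₁, e₂, dist_eq_norm, dist_eq_norm]
    exact h a ha b hb v₁ hv₁ v₂ hv₂
  · rintro ⟨δ, hδ, h⟩
    refine ⟨δ, hδ, fun a ha b hb v₁ hv₁ v₂ hv₂ => (h a ha b hb).trans_le (max_le_max ?_ ?_)⟩
    · rw [← dist_eq_norm]
      exact Metric.infDist_le_dist_of_mem hv₁
    · rw [← dist_eq_norm]
      exact Metric.infDist_le_dist_of_mem hv₂

theorem ne_of_mem_diff {X : Type*} {A B : Set X} {a b : X} (ha : a ∈ A \ B) (hb : b ∈ B \ A) :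
    a ≠ b := by
  rintro rfl
  exact ha.2 hb.1

/-- A vector within `ε` of a unit vector `d` has norm at most `1 + ε` and inner product with `d` at
least `1 - ε`, and `(1 - 2 * ε) * (1 + ε) ≤ 1 - ε`. -/
theorem le_inner_normalize_of_norm_sub_le {d v : E} (hd : ‖d‖ = 1) {ε : ℝ} (hε : ε < 1)
    (h : ‖d - v‖ ≤ ε) : v ≠ 0 ∧ 1 - 2 * ε ≤ inner ℝ d (‖v‖⁻¹ • v) := by
  have hv0 : v ≠ 0 := by
    rintro rfl
    rw [sub_zero, hd] at h
    linarith
  have hvpos : 0 < ‖v‖ := norm_pos_iff.2 hv0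
  have h1 : 1 - ε ≤ inner ℝ d v := by
    have e : inner ℝ d v = 1 - inner ℝ d (d - v) := by
      rw [inner_sub_right, real_inner_self_eq_norm_sq, hd]
      ring
    have := real_inner_le_norm d (d - v)
    rw [hd, one_mul] at this
    linarith
  have h2 : ‖v‖ ≤ 1 + ε := by
    have := norm_sub_norm_le v d
    rw [norm_sub_rev] at this
    linarith
  refine ⟨hv0, ?_⟩
  rw [inner_smul_right, inv_mul_eq_div, le_div_iff₀ hvpos]
  rcases le_total (1 - 2 * ε) 0 with h3 | h3
  · nlinarith
  · nlinarith [norm_nonneg (d - v)]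

theorem HatInnerLt.hatNormGt {α : ℝ} (hα : α ∈ Set.Ioo (0 : ℝ) 1) (h : HatInnerLt A B p α) :
    HatNormGt A B p ((1 - α) / 2) := by
  obtain ⟨δ, hδ, h⟩ := h
  refine ⟨δ, hδ, fun a ha b hb v₁ hv₁ v₂ hv₂ => ?_⟩
  by_contra! hle
  have hab := ne_of_mem_diff ha.1 hb.1
  have hε : (1 - α) / 2 < 1 := by linarith [hα.1]
  obtain ⟨n₁, i₁⟩ := le_inner_normalize_of_norm_sub_le (norm_dir hab) hε (max_le_iff.1 hle).1
  obtain ⟨n₂, i₂⟩ := le_inner_normalize_of_norm_sub_le (norm_dir hab.symm) hε (max_le_iff.1 hle).2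
  have hlt := h a ha b hb _
    (smul_mem_frechetNormalCone hv₁ (inv_pos.2 (norm_pos_iff.2 n₁))) _
    (smul_mem_frechetNormalCone hv₂ (inv_pos.2 (norm_pos_iff.2 n₂)))
    (norm_inv_norm_smul n₁) (norm_inv_norm_smul n₂)
  have := le_min i₁ i₂
  linarith

/-! ### Subtransversality and directions -/

/-- If `v₁` and `v₂` are close to the two directions between `a` and `b`, then a point of `A ∩ B`,
lying in both half-spaces `⟪v₁, · - a⟫ ≤ 0` and `⟪v₂, · - b⟫ ≤ 0`, is far from `a` compared with
`‖b - a‖ ≥ d(a, B)`. -/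
theorem IsSubtransversal.exists_hatNormGt [FiniteDimensional ℝ E] (hA : IsClosed A)
    (hB : IsClosed B) (hAc : Convex ℝ A) (hBc : Convex ℝ B) (hp : p ∈ A ∩ B)
    (h : IsSubtransversal A B p) : ∃ α ∈ Set.Ioo (0 : ℝ) 1, HatNormGt A B p α := by
  obtain ⟨α, ⟨hα0, hα1⟩, δ, hδ, h⟩ := h
  -- Normals within `ε` of the directions give `‖b - a‖ ≤ ε * (‖z - a‖ + ‖z - b‖)`, which is at most
  -- `ε * (2 / α + 1) * ‖b - a‖`; for `ε = α / 4` the factor is below `1`.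
  refine ⟨α / 4, ⟨by linarith, by linarith⟩, δ, hδ, fun a ha b hb v₁ hv₁ v₂ hv₂ => ?_⟩
  by_contra! hle
  obtain ⟨hle₁, hle₂⟩ := max_le_iff.1 hle
  have hab := ne_of_mem_diff ha.1 hb.1
  obtain ⟨z, hz, hza⟩ := (hA.inter hB).exists_infDist_eq_dist ⟨p, hp⟩ a
  have hs := h a ha.2
  rw [hza, Metric.infDist_zero_of_mem ha.1.1, max_eq_right Metric.infDist_nonneg] at hs
  have hd : α * ‖z - a‖ ≤ ‖b - a‖ := by
    rw [← dist_eq_norm, ← dist_eq_norm, dist_comm z, dist_comm b]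
    exact hs.trans (Metric.infDist_le_dist_of_mem hb.1.1)
  have hpos : 0 < ‖b - a‖ := norm_pos_iff.2 (sub_ne_zero.2 hab.symm)
  have i₁ := (mem_frechetNormalCone_iff hAc ha.1.1).1 hv₁ z hz.1
  have i₂ := (mem_frechetNormalCone_iff hBc hb.1.1).1 hv₂ z hz.2
  have c₁ := real_inner_le_norm (dir a b - v₁) (z - a)
  have c₂ := real_inner_le_norm (dir b a - v₂) (z - b)
  have hzb : ‖z - b‖ ≤ ‖z - a‖ + ‖b - a‖ := by
    rw [norm_sub_rev b a]
    exact norm_sub_le_norm_sub_add_norm_sub z a b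
  have e : inner ℝ (dir a b) (z - a) + inner ℝ (dir b a) (z - b) = ‖b - a‖ := by
    rw [dir_swap a b, inner_neg_left, ← sub_eq_add_neg, ← inner_sub_right, sub_sub_sub_cancel_left,
      dir, real_inner_smul_left, real_inner_self_eq_norm_sq]
    field_simp
  rw [inner_sub_left] at c₁ c₂
  have m₁ : ‖dir a b - v₁‖ * ‖z - a‖ ≤ α / 4 * ‖z - a‖ := by gcongr
  have m₂ : ‖dir b a - v₂‖ * ‖z - b‖ ≤ α / 4 * (‖z - a‖ + ‖b - a‖) := by gcongr
  nlinarith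

/-- First-order optimality: if `a` minimizes `z ↦ ‖z - b‖ + ε * ‖z - a‖` over the convex set `A`,
then the direction from `a` to `b` is within `ε` of the normal cone. -/
theorem infDist_dir_le [FiniteDimensional ℝ E] (hA : Convex ℝ A) {a b : E} (ha : a ∈ A)
    (hab : a ≠ b) {ε : ℝ} (hε : 0 ≤ ε) (h : ∀ z ∈ A, ‖a - b‖ ≤ ‖z - b‖ + ε * ‖z - a‖) :
    Metric.infDist (dir a b) (frechetNormalCone A a) ≤ ε := by
  refine infDist_frechetNormalCone_le hA ha hε fun z hz => ?_
  have hpos : 0 < ‖b - a‖ := norm_pos_iff.2 (sub_ne_zero.2 hab.symm)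
  have key : ∀ t : ℝ, 0 < t → t ≤ 1 →
      2 * inner ℝ (b - a) (z - a) ≤ t * ‖z - a‖ ^ 2 + 2 * (ε * ‖z - a‖) * ‖b - a‖ := by
    intro t ht ht1
    have hm := h (a + t • (z - a)) (hA.add_smul_sub_mem ha hz ⟨ht.le, ht1⟩)
    rw [add_sub_cancel_left, norm_smul, Real.norm_of_nonneg ht.le, norm_sub_rev a b] at hm
    have hsq : ‖a + t • (z - a) - b‖ ^ 2 =
        t ^ 2 * ‖z - a‖ ^ 2 - 2 * (t * inner ℝ (b - a) (z - a)) + ‖b - a‖ ^ 2 := by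
      rw [show a + t • (z - a) - b = t • (z - a) - (b - a) by abel, norm_sub_sq_real,
        norm_smul, Real.norm_of_nonneg ht.le, real_inner_smul_left, real_inner_comm]
      ring
    -- `‖a + t • (z - a) - b‖ * ‖b - a‖` is at most the mean of the squares of the two factors, so
    -- `hm` may be multiplied by `‖b - a‖` instead of being squared, which needs no sign condition.
    have hAG := sq_nonneg (‖a + t • (z - a) - b‖ - ‖b - a‖)
    have : t * (2 * inner ℝ (b - a) (z - a)) ≤
        t * (t * ‖z - a‖ ^ 2 + 2 * (ε * ‖z - a‖) * ‖b - a‖) := by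
      nlinarith [mul_le_mul_of_nonneg_right hm hpos.le]
    exact le_of_mul_le_mul_left this ht
  have hlim : Tendsto (fun t : ℝ => t * ‖z - a‖ ^ 2 + 2 * (ε * ‖z - a‖) * ‖b - a‖) (𝓝[>] 0)
      (𝓝 (2 * (ε * ‖z - a‖) * ‖b - a‖)) := by
    have hc : Continuous fun t : ℝ => t * ‖z - a‖ ^ 2 + 2 * (ε * ‖z - a‖) * ‖b - a‖ := by fun_prop
    simpa using (hc.tendsto 0).mono_left (nhdsWithin_le_nhds (s := Set.Ioi (0 : ℝ)))
  have hle := ge_of_tendsto hlim (b := 2 * inner ℝ (b - a) (z - a)) <| by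
    filter_upwards [Ioo_mem_nhdsGT (zero_lt_one' ℝ)] with t ht
    exact key t ht.1 ht.2.le
  rw [dir, real_inner_smul_left, inv_mul_le_iff₀ hpos]
  linarith

/-- Ekeland's variational principle for the distance between points of `A` and `B`; in finite
dimension the perturbed distance attains its minimum. -/
theorem exists_perturbed_minimizer [FiniteDimensional ℝ E] (hA : IsClosed A) (hB : IsClosed B)
    {a₀ b₀ : E} (ha₀ : a₀ ∈ A) (hb₀ : b₀ ∈ B) {ε : ℝ} (hε : 0 < ε) :
    ∃ a ∈ A, ∃ b ∈ B, ε * (‖a - a₀‖ + ‖b - b₀‖) ≤ ‖a₀ - b₀‖ ∧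
      (∀ z ∈ A, ‖a - b‖ ≤ ‖z - b‖ + ε * ‖z - a‖) ∧
      ∀ z ∈ B, ‖b - a‖ ≤ ‖z - a‖ + ε * ‖z - b‖ := by
  set f : E × E → ℝ := fun w => ‖w.1 - w.2‖ + ε * (‖w.1 - a₀‖ + ‖w.2 - b₀‖) with hf
  have hcont : Continuous f := by fun_prop
  have hlarge : ∀ᶠ w in cocompact (E × E), f (a₀, b₀) ≤ ε * dist w (a₀, b₀) :=
    ((tendsto_dist_right_cocompact_atTop (a₀, b₀)).const_mul_atTop hε).eventually_ge_atTop _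
  have hcoer : ∀ᶠ w in cocompact (E × E) ⊓ 𝓟 (A ×ˢ B), f (a₀, b₀) ≤ f w := by
    refine Eventually.filter_mono inf_le_left (hlarge.mono fun w hw => hw.trans ?_)
    have hd : dist w (a₀, b₀) ≤ ‖w.1 - a₀‖ + ‖w.2 - b₀‖ := by
      rw [Prod.dist_eq, dist_eq_norm, dist_eq_norm]
      exact max_le_add_of_nonneg (norm_nonneg _) (norm_nonneg _)
    exact (mul_le_mul_of_nonneg_left hd hε.le).trans (le_add_of_nonneg_left (norm_nonneg _))
  obtain ⟨⟨a, b⟩, ⟨ha, hb⟩, hmin⟩ := hcont.continuousOn.exists_isMinOn' (hA.prod hB)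
    (x₀ := (a₀, b₀)) ⟨ha₀, hb₀⟩ hcoer
  have hmin' : ∀ y ∈ A, ∀ z ∈ B, f (a, b) ≤ f (y, z) :=
    fun y hy z hz => hmin (Set.mk_mem_prod hy hz)
  simp only [hf] at hmin'
  refine ⟨a, ha, b, hb, ?_, fun z hz => ?_, fun z hz => ?_⟩
  · have := hmin' a₀ ha₀ b₀ hb₀
    simp only [sub_self, norm_zero, add_zero, mul_zero] at this
    linarith [norm_nonneg (a - b)]
  · have h1 := hmin' z hz b hb
    have h2 : ε * ‖z - a₀‖ ≤ ε * (‖z - a‖ + ‖a - a₀‖) := by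
      gcongr
      exact norm_sub_le_norm_sub_add_norm_sub z a a₀
    linarith
  · have h1 := hmin' a ha z hz
    have h2 : ε * ‖z - b₀‖ ≤ ε * (‖z - b‖ + ‖b - b₀‖) := by
      gcongr
      exact norm_sub_le_norm_sub_add_norm_sub z b b₀
    rw [norm_sub_rev b a, norm_sub_rev z a]
    linarith

/-- If subtransversality fails at `x`, the perturbed minimizers started at the projections of `x`
stay closer to `x` than `A ∩ B`; hence they lie in `A \ B` and `B \ A`, and by optimality the
directions between them are nearly normal. -/
theorem HatDistGt.isSubtransversal [FiniteDimensional ℝ E] (hA : IsClosed A) (hB : IsClosed B)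
    (hAc : Convex ℝ A) (hBc : Convex ℝ B) (hp : p ∈ A ∩ B) {α : ℝ} (hα : 0 < α)
    (h : HatDistGt A B p α) : IsSubtransversal A B p := by
  obtain ⟨δ, hδ, h⟩ := h
  -- The minimizers stay within `(κ + 2 * κ / α) * d(x, A ∩ B)` of `x`; this `κ` makes it
  -- `d(x, A ∩ B)`.
  have hκ : α / (α + 2) * (1 + 2 / α) = 1 := by field_simp
  set κ := α / (α + 2) with hκdef
  have hκ0 : 0 < κ := by positivity
  refine ⟨κ, ⟨hκ0, (div_lt_one (by positivity)).2 (by linarith)⟩, δ / 2, by positivity,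
    fun x hx => ?_⟩
  by_contra! hlt
  obtain ⟨hltA, hltB⟩ := max_lt_iff.1 hlt
  set D := Metric.infDist x (A ∩ B) with hD
  obtain ⟨a₀, ha₀, ea⟩ := hA.exists_infDist_eq_dist ⟨p, hp.1⟩ x
  obtain ⟨b₀, hb₀, eb⟩ := hB.exists_infDist_eq_dist ⟨p, hp.2⟩ x
  rw [ea] at hltA
  rw [eb] at hltB
  obtain ⟨a, ha, b, hb, hsmall, hmina, hminb⟩ := exists_perturbed_minimizer hA hB ha₀ hb₀ hα
  have h₀ : ‖a₀ - b₀‖ < 2 * (κ * D) := by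
    rw [← dist_eq_norm]
    linarith [dist_triangle_left a₀ b₀ x]
  have hsum : ‖a - a₀‖ + ‖b - b₀‖ < 2 / α * (κ * D) := by
    rw [div_mul_eq_mul_div, lt_div_iff₀ hα]
    linarith
  have hDeq : κ * D + 2 / α * (κ * D) = D := by
    linear_combination D * hκ
  have hxa : dist x a < D := by
    have := dist_triangle x a₀ a
    rw [dist_comm a₀, dist_eq_norm a] at this
    linarith [norm_nonneg (b - b₀)]
  have hxb : dist x b < D := by
    have := dist_triangle x b₀ b
    rw [dist_comm b₀, dist_eq_norm b] at this
    linarith [norm_nonneg (a - a₀)]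
  have haB : a ∉ B := fun haB => (Metric.infDist_le_dist_of_mem (Set.mem_inter ha haB)).not_gt hxa
  have hbA : b ∉ A := fun hbA => (Metric.infDist_le_dist_of_mem (Set.mem_inter hbA hb)).not_gt hxb
  have hDp : D < δ / 2 := (Metric.infDist_le_dist_of_mem hp).trans_lt hx
  have hxp : dist x p < δ / 2 := hx
  have hap : dist a p < δ := by linarith [dist_triangle_left a p x]
  have hbp : dist b p < δ := by linarith [dist_triangle_left b p x]
  have hab : a ≠ b := ne_of_mem_diff ⟨ha, haB⟩ ⟨hb, hbA⟩
  exact (h a ⟨⟨ha, haB⟩, hap⟩ b ⟨⟨hb, hbA⟩, hbp⟩).not_ge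
    (max_le (infDist_dir_le hAc ha hab hα.le hmina) (infDist_dir_le hBc hb hab.symm hα.le hminb))

/-! ### Directions and relative limiting normals -/

/-- If the cosines of the angles between normals and directions are close to `1`, the midpoint of
`a` and `b` serves as `x` in the definition of relative limiting normals. -/
theorem exists_hatInnerLt_of_forall_norm_add [FiniteDimensional ℝ E] {α : ℝ} (hα : 0 < α)
    (h : ∀ w ∈ unitRelLimitingNormals A B p, α < ‖w.1 + w.2‖) :
    ∃ β ∈ Set.Ioo (0 : ℝ) 1, HatInnerLt A B p β := by
  by_contra! hcon
  obtain ⟨w, hw, hle⟩ := exists_unitRelLimitingNormals_le (A := A) (B := B) (p := p)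
    (f := fun w => ‖w.1 + w.2‖) (c := α) (by fun_prop) fun ρ hρ => by
    -- A cosine of at least `β > 1 - α ^ 2 / 8` gives
    -- `‖dir a b - v‖ ^ 2 = 2 - 2 * cosine < α ^ 2 / 4`.
    obtain ⟨β, hβ0, hβ1⟩ : ∃ β : ℝ, max (max 0 (1 - ρ)) (1 - α ^ 2 / 8) < β ∧ β < 1 :=
      exists_between (by
        refine max_lt (max_lt one_pos (by linarith)) ?_
        have : 0 < α ^ 2 := by positivity
        linarith)
    simp only [max_lt_iff] at hβ0
    have hn := hcon β ⟨hβ0.1.1, hβ1⟩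
    simp only [HatInnerLt] at hn
    push Not at hn
    obtain ⟨a, ha, b, hb, v₁, hv₁, v₂, hv₂, h₁, h₂, hmin⟩ := hn ρ hρ
    obtain ⟨m₁, m₂⟩ := le_min_iff.1 hmin
    have hab := ne_of_mem_diff ha.1 hb.1
    have hna : midpoint ℝ a b ≠ a := fun he => hab ((midpoint_eq_left_iff ℝ).1 he)
    have hnb : midpoint ℝ a b ≠ b := fun he => hab ((midpoint_eq_right_iff ℝ).1 he)
    refine ⟨(v₁, v₂), ⟨a, ha, b, hb, midpoint ℝ a b,
      (convex_ball p ρ).midpoint_mem ha.2 hb.2, hna, hnb, hv₁, hv₂, ?_, ?_, ?_⟩, h₁, h₂, ?_⟩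
    · rw [← dist_eq_norm, ← dist_eq_norm, dist_midpoint_left, dist_midpoint_right, div_self]
      · exact ⟨by linarith, by linarith⟩
      · simpa using hab
    · rw [cosine_midpoint_sub_left hab h₁]
      linarith
    · rw [midpoint_comm, cosine_midpoint_sub_left hab.symm h₂]
      linarith
    · have key : ∀ {d v : E}, ‖d‖ = 1 → ‖v‖ = 1 → β ≤ inner ℝ d v → ‖d - v‖ ≤ α / 2 := by
        intro d v hd hv hi
        refine abs_le_of_sq_le_sq' ?_ (by positivity) |>.2
        rw [norm_sub_sq_of_unit hd hv]
        nlinarith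
      have k₁ := key (norm_dir hab) h₁ m₁
      have k₂ := key (norm_dir hab.symm) h₂ m₂
      calc ‖v₁ + v₂‖ = ‖(dir a b - v₁) + (dir b a - v₂)‖ := by
            rw [dir_swap a b, ← norm_neg]
            congr 1
            abel
        _ ≤ α / 2 + α / 2 := (norm_add_le _ _).trans (add_le_add k₁ k₂)
        _ = α := by ring
  exact (h w hw).not_ge hle

/-- For an antipodal unit pair `(u, -u)` of relative limiting normals, the vectors `x - a` and
`x - b` are asymptotically `r • u` and `-r • u` with the same `r`, so the directions from `a` to
`b` converge to `u`, as do the normals at `a`. -/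
theorem HatNormGt.norm_add_ne_zero {α : ℝ} (hα : 0 < α) (h : HatNormGt A B p α) :
    ∀ w ∈ unitRelLimitingNormals A B p, w.1 + w.2 ≠ 0 := by
  rintro ⟨u, u'⟩ ⟨⟨a, b, x, v₁, v₂, ha, hb, hxa, hxb, ta, tb, tx, t₁, t₂, h₁, h₂, tr, tc₁, tc₂⟩,
    hu, hu'⟩ h0
  obtain rfl : u' = -u := eq_neg_of_add_eq_zero_right h0
  obtain ⟨δ, hδ, h⟩ := h
  dsimp only at t₁ t₂ hu hu'
  have e₁ := tendsto_normalize_of_cosine hu t₁ (fun k => sub_ne_zero.2 (hxa k)) tc₁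
  have e₂ := tendsto_normalize_of_cosine hu' t₂ (fun k => sub_ne_zero.2 (hxb k)) tc₂
  have tdir : Tendsto (fun k => dir (a k) (b k)) atTop (𝓝 u) := by
    have ty : Tendsto (fun k => (‖x k - a k‖ / ‖x k - b k‖) • (‖x k - a k‖⁻¹ • (x k - a k)) -
        ‖x k - b k‖⁻¹ • (x k - b k)) atTop (𝓝 ((2 : ℝ) • u)) := by
      have := (tr.smul e₁).sub e₂
      rwa [one_smul, sub_neg_eq_add, ← two_smul ℝ u] at this
    have hy : ∀ k, (‖x k - a k‖ / ‖x k - b k‖) • (‖x k - a k‖⁻¹ • (x k - a k)) -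
        ‖x k - b k‖⁻¹ • (x k - b k) = ‖x k - b k‖⁻¹ • (b k - a k) := by
      intro k
      have hk : ‖x k - a k‖ ≠ 0 := norm_ne_zero_iff.2 (sub_ne_zero.2 (hxa k))
      rw [smul_smul, div_mul_eq_mul_div, mul_inv_cancel₀ hk, one_div, ← smul_sub]
      congr 1
      abel
    simp only [hy] at ty
    have h2 : ‖(2 : ℝ) • u‖ = 2 := by rw [norm_smul, hu]; norm_num
    have tn := (ty.norm.inv₀ (by rw [h2]; norm_num)).smul ty
    rw [h2, smul_smul, inv_mul_cancel₀ (by norm_num), one_smul] at tn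
    refine tn.congr fun k => ?_
    have hk : ‖x k - b k‖ ≠ 0 := norm_ne_zero_iff.2 (sub_ne_zero.2 (hxb k))
    rw [dir, norm_smul, norm_inv, norm_norm, mul_inv, inv_inv, smul_smul]
    congr 1
    field_simp
  have tdir' : Tendsto (fun k => dir (b k) (a k)) atTop (𝓝 (-u)) :=
    tdir.neg.congr fun k => (dir_swap _ _).symm
  have n₁ : Tendsto (fun k => ‖dir (a k) (b k) - v₁ k‖) atTop (𝓝 0) := by
    simpa using (tdir.sub t₁).norm
  have n₂ : Tendsto (fun k => ‖dir (b k) (a k) - v₂ k‖) atTop (𝓝 0) := by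
    simpa using (tdir'.sub t₂).norm
  obtain ⟨k, k₁, k₂, ka, kb⟩ := ((n₁.eventually_lt_const hα).and ((n₂.eventually_lt_const hα).and
    ((ta.eventually_mem (Metric.ball_mem_nhds p hδ)).and
      (tb.eventually_mem (Metric.ball_mem_nhds p hδ))))).exists
  exact (h (a k) ⟨ha k, ka⟩ (b k) ⟨hb k, kb⟩ _ (h₁ k) _ (h₂ k)).not_gt (max_lt k₁ k₂)

/-! ### Lower and upper limits of families of sets of reals -/

theorem exists_forall_lt_of_lt_sSup_infOr {V : ℝ → Set ℝ} (hV : ∀ ρ, ∀ r ∈ V ρ, 0 ≤ r) {α : ℝ}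
    (h : α < sSup ((fun ρ => infOr 1 (V ρ)) '' Set.Ioi 0)) : ∃ ρ > 0, ∀ r ∈ V ρ, α < r := by
  obtain ⟨_, ⟨ρ, hρ, rfl⟩, hlt⟩ := exists_lt_of_lt_csSup (Set.nonempty_Ioi.image _) h
  refine ⟨ρ, hρ, fun r hr => hlt.trans_le ?_⟩
  dsimp only
  rw [infOr, if_neg (Set.nonempty_iff_ne_empty.1 ⟨r, hr⟩)]
  exact csInf_le ⟨0, fun s hs => hV ρ s hs⟩ hr

theorem infOr_one_le_one {S : Set ℝ} (hS : ∀ r ∈ S, 0 ≤ r ∧ r ≤ 1) : infOr 1 S ≤ 1 := by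
  rw [infOr]
  split_ifs with h
  · exact le_rfl
  · obtain ⟨r, hr⟩ := Set.nonempty_iff_ne_empty.2 h
    exact (csInf_le ⟨0, fun s hs => (hS s hs).1⟩ hr).trans (hS r hr).2

theorem sSup_infOr_le_one {V : ℝ → Set ℝ} (hV : ∀ ρ, ∀ r ∈ V ρ, 0 ≤ r ∧ r ≤ 1) :
    sSup ((fun ρ => infOr 1 (V ρ)) '' Set.Ioi 0) ≤ 1 := by
  refine csSup_le (Set.nonempty_Ioi.image _) ?_
  rintro _ ⟨ρ, -, rfl⟩
  exact infOr_one_le_one (hV ρ)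

theorem le_sSup_infOr {V : ℝ → Set ℝ} (hV : ∀ ρ, ∀ r ∈ V ρ, 0 ≤ r ∧ r ≤ 1) {α : ℝ} (hα : α ≤ 1)
    (h : ∃ ρ > 0, ∀ r ∈ V ρ, α ≤ r) :
    α ≤ sSup ((fun ρ => infOr 1 (V ρ)) '' Set.Ioi 0) := by
  obtain ⟨ρ, hρ, h⟩ := h
  refine le_csSup_of_le ⟨1, ?_⟩ (Set.mem_image_of_mem _ hρ) ?_
  · rintro _ ⟨σ, -, rfl⟩
    exact infOr_one_le_one (hV σ)
  · rw [infOr]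
    split_ifs with hne
    · exact hα
    · exact le_csInf (Set.nonempty_iff_ne_empty.2 hne) h

theorem exists_forall_lt_of_sInf_supOr_lt {V : ℝ → Set ℝ} (hV : ∀ ρ, ∀ r ∈ V ρ, r ≤ 1) {α : ℝ}
    (h : sInf ((fun ρ => supOr 0 (V ρ)) '' Set.Ioi 0) < α) : ∃ ρ > 0, ∀ r ∈ V ρ, r < α := by
  obtain ⟨_, ⟨ρ, hρ, rfl⟩, hlt⟩ := exists_lt_of_csInf_lt (Set.nonempty_Ioi.image _) h
  refine ⟨ρ, hρ, fun r hr => lt_of_le_of_lt ?_ hlt⟩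
  dsimp only
  rw [supOr, if_neg (Set.nonempty_iff_ne_empty.1 ⟨r, hr⟩)]
  exact le_csSup ⟨1, fun s hs => hV ρ s hs⟩ hr

theorem zero_le_supOr_zero {S : Set ℝ} (hS : ∀ r ∈ S, 0 ≤ r) : 0 ≤ supOr 0 S := by
  rw [supOr]
  split_ifs
  · exact le_rfl
  · exact Real.sSup_nonneg hS

theorem zero_le_sInf_supOr {V : ℝ → Set ℝ} (hV : ∀ ρ, ∀ r ∈ V ρ, 0 ≤ r) :
    0 ≤ sInf ((fun ρ => supOr 0 (V ρ)) '' Set.Ioi 0) := by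
  refine Real.sInf_nonneg ?_
  rintro _ ⟨ρ, -, rfl⟩
  exact zero_le_supOr_zero (hV ρ)

theorem sInf_supOr_le {V : ℝ → Set ℝ} (hV : ∀ ρ, ∀ r ∈ V ρ, 0 ≤ r) {α : ℝ} (hα : 0 ≤ α)
    (h : ∃ ρ > 0, ∀ r ∈ V ρ, r ≤ α) :
    sInf ((fun ρ => supOr 0 (V ρ)) '' Set.Ioi 0) ≤ α := by
  obtain ⟨ρ, hρ, h⟩ := h
  refine csInf_le_of_le ⟨0, ?_⟩ (Set.mem_image_of_mem _ hρ) ?_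
  · rintro _ ⟨σ, -, rfl⟩
    exact zero_le_supOr_zero (hV σ)
  · rw [supOr]
    split_ifs with hne
    · exact hα
    · exact csSup_le (Set.nonempty_iff_ne_empty.2 hne) h

theorem isLUB_of_forall_Ioo {T : Set ℝ} {l s : ℝ} (hls : l < s) (h₁ : ∀ α ∈ Set.Ioo l s, α ∈ T)
    (h₂ : ∀ α ∈ T, α ≤ s) : IsLUB T s :=
  ⟨h₂, fun c hc => by simpa using (isLUB_Ioo hls).2 fun α hα => hc (h₁ α hα)⟩

theorem isGLB_of_forall_Ioo {T : Set ℝ} {s u : ℝ} (hsu : s < u) (h₁ : ∀ α ∈ Set.Ioo s u, α ∈ T)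
    (h₂ : ∀ α ∈ T, s ≤ α) : IsGLB T s :=
  ⟨h₂, fun c hc => by simpa using (isGLB_Ioo hsu).2 fun α hα => hc (h₁ α hα)⟩

/-! ### The constants defined through directions -/

/-- The values entering the lower limit that defines `itrHat₁`, at scale `ρ`. -/
def hatDistValues (A B : Set E) (p : E) (ρ : ℝ) : Set ℝ :=
  {r | ∃ a ∈ (A \ B) ∩ Metric.ball p ρ, ∃ b ∈ (B \ A) ∩ Metric.ball p ρ,
    r = max (Metric.infDist (dir a b) (frechetNormalCone A a))
      (Metric.infDist (dir b a) (frechetNormalCone B b))}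

/-- The values entering the upper limit that defines `itrHat₂`, at scale `ρ`. -/
def hatInnerValues (A B : Set E) (p : E) (ρ : ℝ) : Set ℝ :=
  {r | ∃ a ∈ (A \ B) ∩ Metric.ball p ρ, ∃ b ∈ (B \ A) ∩ Metric.ball p ρ,
    ∃ v₁ ∈ frechetNormalCone A a, ∃ v₂ ∈ frechetNormalCone B b, ‖v₁‖ = 1 ∧ ‖v₂‖ = 1 ∧
      r = max (min (inner ℝ (dir a b) v₁) (inner ℝ (dir b a) v₂)) 0}

theorem hatDistValues_bounds (ρ : ℝ) : ∀ r ∈ hatDistValues A B p ρ, 0 ≤ r ∧ r ≤ 1 := by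
  rintro _ ⟨a, -, b, -, rfl⟩
  have key : ∀ (C : Set E) (c d : E), Metric.infDist (dir c d) (frechetNormalCone C c) ≤ 1 := by
    intro C c d
    refine (Metric.infDist_le_dist_of_mem (zero_mem_frechetNormalCone C c)).trans ?_
    rw [dist_zero_right]
    exact norm_dir_le c d
  exact ⟨le_max_of_le_left Metric.infDist_nonneg, max_le (key A a b) (key B b a)⟩

theorem hatInnerValues_bounds (ρ : ℝ) : ∀ r ∈ hatInnerValues A B p ρ, 0 ≤ r ∧ r ≤ 1 := by
  rintro _ ⟨a, -, b, -, v₁, -, v₂, -, h₁, -, rfl⟩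
  refine ⟨le_max_right _ _, max_le ((min_le_left _ _).trans ?_) zero_le_one⟩
  have := real_inner_le_norm (dir a b) v₁
  rw [h₁, mul_one] at this
  exact this.trans (norm_dir_le a b)

theorem itrHat₁_le_one : itrHat₁ A B p ≤ 1 := sSup_infOr_le_one hatDistValues_bounds

theorem hatDistGt_of_lt_itrHat₁ {α : ℝ} (h : α < itrHat₁ A B p) : HatDistGt A B p α := by
  obtain ⟨ρ, hρ, h⟩ := exists_forall_lt_of_lt_sSup_infOr
    (V := hatDistValues A B p)
    (fun ρ r hr => (hatDistValues_bounds ρ r hr).1) h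
  exact ⟨ρ, hρ, fun a ha b hb => h _ ⟨a, ha, b, hb, rfl⟩⟩

theorem HatDistGt.le_itrHat₁ {α : ℝ} (hα : α ≤ 1) (h : HatDistGt A B p α) :
    α ≤ itrHat₁ A B p := by
  obtain ⟨ρ, hρ, h⟩ := h
  refine le_sSup_infOr hatDistValues_bounds hα ⟨ρ, hρ, ?_⟩
  rintro _ ⟨a, ha, b, hb, rfl⟩
  exact (h a ha b hb).le

theorem itrHat₂_nonneg : 0 ≤ itrHat₂ A B p :=
  zero_le_sInf_supOr fun ρ r hr => (hatInnerValues_bounds ρ r hr).1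

theorem hatInnerLt_of_itrHat₂_lt {α : ℝ} (h : itrHat₂ A B p < α) : HatInnerLt A B p α := by
  obtain ⟨ρ, hρ, h⟩ := exists_forall_lt_of_sInf_supOr_lt
    (V := hatInnerValues A B p)
    (fun ρ r hr => (hatInnerValues_bounds ρ r hr).2) h
  exact ⟨ρ, hρ, fun a ha b hb v₁ hv₁ v₂ hv₂ h₁ h₂ => (le_max_left _ _).trans_lt
    (h _ ⟨a, ha, b, hb, v₁, hv₁, v₂, hv₂, h₁, h₂, rfl⟩)⟩

theorem HatInnerLt.itrHat₂_le {α : ℝ} (hα : 0 ≤ α) (h : HatInnerLt A B p α) :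
    itrHat₂ A B p ≤ α := by
  obtain ⟨ρ, hρ, h⟩ := h
  refine sInf_supOr_le (fun ρ r hr => (hatInnerValues_bounds ρ r hr).1) hα ⟨ρ, hρ, ?_⟩
  rintro _ ⟨a, ha, b, hb, v₁, hv₁, v₂, hv₂, h₁, h₂, rfl⟩
  exact max_le (h a ha b hb v₁ hv₁ v₂ hv₂ h₁ h₂).le hα

/-! ### The constants defined through normals -/

theorem itrValues_bounds (ρ : ℝ) : ∀ r ∈ itrValues A B p ρ, 0 ≤ r ∧ r ≤ 1 := by
  rintro _ ⟨a, -, b, -, x, -, -, -, v₁, -, v₂, -, -, -, h, -, -, -, rfl⟩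
  exact ⟨norm_nonneg _, (norm_add_le _ _).trans h.le⟩

theorem itr_le_one : itr A B p ≤ 1 := sSup_infOr_le_one itrValues_bounds

/-- Half the sum of the normalized vectors of a pair of approximate normals is an admissible value
in the definition of `itr`. -/
theorem half_norm_normalize_add_mem_itrValues {ρ : ℝ} {w : E × E}
    (hw : w ∈ approxNormals A B p ρ) (h₁ : w.1 ≠ 0) (h₂ : w.2 ≠ 0) :
    ‖‖w.1‖⁻¹ • w.1 + ‖w.2‖⁻¹ • w.2‖ / 2 ∈ itrValues A B p ρ := by
  have p₁ := norm_pos_iff.2 h₁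
  have p₂ := norm_pos_iff.2 h₂
  have hn : ∀ {v : E}, v ≠ 0 → ‖(2⁻¹ * ‖v‖⁻¹) • v‖ = 2⁻¹ := by
    intro v hv
    rw [mul_smul, norm_smul, norm_inv_norm_smul hv]
    norm_num
  obtain ⟨a, ha, b, hb, x, hx, hxa, hxb, m₁, m₂, hr, hc₁, hc₂⟩ := smul_mem_approxNormals
    (s := 2⁻¹ * ‖w.1‖⁻¹) (t := 2⁻¹ * ‖w.2‖⁻¹) (by positivity) (by positivity) hw
  refine ⟨a, ha, b, hb, x, hx, hxa, hxb, _, m₁, _, m₂, ?_, ?_, ?_, hr, hc₁, hc₂, ?_⟩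
  · exact smul_ne_zero (by positivity) h₁
  · exact smul_ne_zero (by positivity) h₂
  · rw [hn h₁, hn h₂]
    norm_num
  · rw [mul_smul, mul_smul, ← smul_add, norm_smul, norm_inv, Real.norm_two]
    ring

theorem two_mul_lt_norm_add_of_lt_itr {α : ℝ} (h : α < itr A B p) :
    ∀ w ∈ unitRelLimitingNormals A B p, 2 * α < ‖w.1 + w.2‖ := by
  rintro w ⟨hw, h₁, h₂⟩
  obtain ⟨β, hαβ, hβ⟩ := exists_between h
  obtain ⟨ρ, hρ, hlt⟩ := exists_forall_lt_of_lt_sSup_infOr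
    (fun ρ r hr => (itrValues_bounds ρ r hr).1) hβ
  rw [relLimitingNormals_eq_iInter] at hw
  obtain ⟨v, hv, tv⟩ := mem_closure_iff_seq_limit.1 (Set.mem_iInter₂.1 hw ρ hρ)
  have t₁ : Tendsto (fun k => (v k).1) atTop (𝓝 w.1) := (continuous_fst.tendsto w).comp tv
  have t₂ : Tendsto (fun k => (v k).2) atTop (𝓝 w.2) := (continuous_snd.tendsto w).comp tv
  have n₁ : w.1 ≠ 0 := norm_ne_zero_iff.1 (by rw [h₁]; exact one_ne_zero)
  have n₂ : w.2 ≠ 0 := norm_ne_zero_iff.1 (by rw [h₂]; exact one_ne_zero)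
  have tlim : Tendsto (fun k => ‖‖(v k).1‖⁻¹ • (v k).1 + ‖(v k).2‖⁻¹ • (v k).2‖ / 2) atTop
      (𝓝 (‖w.1 + w.2‖ / 2)) := by
    have := ((((t₁.norm.inv₀ (norm_ne_zero_iff.2 n₁)).smul t₁).add
      ((t₂.norm.inv₀ (norm_ne_zero_iff.2 n₂)).smul t₂)).norm.div_const 2)
    simpa [h₁, h₂] using this
  have hle : β ≤ ‖w.1 + w.2‖ / 2 := by
    refine ge_of_tendsto tlim ?_
    filter_upwards [t₁.eventually_ne n₁, t₂.eventually_ne n₂] with k k₁ k₂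
    exact (hlt _ (half_norm_normalize_add_mem_itrValues (hv k) k₁ k₂)).le
  linarith

theorem le_two_mul_itr [FiniteDimensional ℝ E] {α : ℝ} (hα : α ≤ 2)
    (h : ∀ w ∈ unitRelLimitingNormals A B p, α < ‖w.1 + w.2‖) : α ≤ 2 * itr A B p := by
  have : α / 2 ≤ itr A B p := by
    refine le_sSup_infOr itrValues_bounds (by linarith) ?_
    by_contra! hcon
    obtain ⟨w, hw, hle⟩ := exists_unitRelLimitingNormals_le (A := A) (B := B) (p := p)
      (f := fun w => ‖w.1 + w.2‖) (c := α) (by fun_prop) fun ρ hρ => by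
      obtain ⟨_, ⟨a, ha, b, hb, x, hx, hxa, hxb, v₁, hv₁, v₂, hv₂, n₁, n₂, hsum, hr, hc₁, hc₂,
        rfl⟩, hlt⟩ := hcon ρ hρ
      refine ⟨_, smul_mem_approxNormals (w := (v₁, v₂)) (inv_pos.2 (norm_pos_iff.2 n₁))
        (inv_pos.2 (norm_pos_iff.2 n₂)) ⟨a, ha, b, hb, x, hx, hxa, hxb, hv₁, hv₂, hr, hc₁, hc₂⟩,
        norm_inv_norm_smul n₁, norm_inv_norm_smul n₂, ?_⟩
      have := norm_normalize_add_normalize_le n₁ n₂ hsum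
      dsimp only
      linarith
    exact (h w hw).not_ge hle
  linarith

theorem exists_eq_supOr_image {X : Type*} [TopologicalSpace X] {K : Set X} (hK : IsCompact K)
    (hne : K.Nonempty) {f : X → ℝ} (hf : Continuous f) (c : ℝ) :
    ∃ w ∈ K, f w = supOr c (f '' K) ∧ ∀ v ∈ K, f v ≤ f w := by
  obtain ⟨w, hw, hmax⟩ := hK.exists_isMaxOn hne hf.continuousOn
  have hg : IsGreatest (f '' K) (f w) :=
    ⟨Set.mem_image_of_mem f hw, Set.forall_mem_image.2 fun v hv => hmax hv⟩
  exact ⟨w, hw, by rw [supOr, if_neg (hne.image f).ne_empty, hg.csSup_eq], fun v hv => hmax hv⟩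

theorem exists_eq_infOr_image {X : Type*} [TopologicalSpace X] {K : Set X} (hK : IsCompact K)
    (hne : K.Nonempty) {f : X → ℝ} (hf : Continuous f) (c : ℝ) :
    ∃ w ∈ K, f w = infOr c (f '' K) ∧ ∀ v ∈ K, f w ≤ f v := by
  obtain ⟨w, hw, hmin⟩ := hK.exists_isMinOn hne hf.continuousOn
  have hg : IsLeast (f '' K) (f w) :=
    ⟨Set.mem_image_of_mem f hw, Set.forall_mem_image.2 fun v hv => hmin hv⟩
  exact ⟨w, hw, by rw [infOr, if_neg (hne.image f).ne_empty, hg.csInf_eq], fun v hv => hmin hv⟩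

theorem itr₁_eq_zero_or [FiniteDimensional ℝ E] :
    (unitRelLimitingNormals A B p = ∅ ∧ itr₁ A B p = 0) ∨
      ∃ w ∈ unitRelLimitingNormals A B p, ‖w.1 - w.2‖ = itr₁ A B p ∧
        ∀ v ∈ unitRelLimitingNormals A B p, ‖v.1 - v.2‖ ≤ itr₁ A B p := by
  rcases (unitRelLimitingNormals A B p).eq_empty_or_nonempty with h | h
  · left
    simp [h, itr₁, supOr]
  · right
    obtain ⟨w, hw, he, hmax⟩ := exists_eq_supOr_image isCompact_unitRelLimitingNormals h
      (f := fun w : E × E => ‖w.1 - w.2‖) (by fun_prop) 0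
    exact ⟨w, hw, he, fun v hv => (hmax v hv).trans_eq he⟩

theorem itr₂_eq_neg_one_or [FiniteDimensional ℝ E] :
    (unitRelLimitingNormals A B p = ∅ ∧ itr₂ A B p = -1) ∨
      ∃ w ∈ unitRelLimitingNormals A B p, -(inner ℝ w.1 w.2 : ℝ) = itr₂ A B p ∧
        ∀ v ∈ unitRelLimitingNormals A B p, -(inner ℝ v.1 v.2 : ℝ) ≤ itr₂ A B p := by
  rcases (unitRelLimitingNormals A B p).eq_empty_or_nonempty with h | h
  · left
    simp [h, itr₂, infOr]
  · right
    obtain ⟨w, hw, he, hmin⟩ := exists_eq_infOr_image isCompact_unitRelLimitingNormals h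
      (f := fun w : E × E => (inner ℝ w.1 w.2 : ℝ)) (by fun_prop) 1
    exact ⟨w, hw, congrArg Neg.neg he, fun v hv =>
      (neg_le_neg (hmin v hv)).trans_eq (congrArg Neg.neg he)⟩

theorem itr₁_nonneg [FiniteDimensional ℝ E] : 0 ≤ itr₁ A B p := by
  rcases itr₁_eq_zero_or (A := A) (B := B) (p := p) with ⟨-, h⟩ | ⟨w, -, h, -⟩
  · exact h.ge
  · exact h ▸ norm_nonneg _

theorem norm_sub_le_itr₁ [FiniteDimensional ℝ E] :
    ∀ w ∈ unitRelLimitingNormals A B p, ‖w.1 - w.2‖ ≤ itr₁ A B p := by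
  rcases itr₁_eq_zero_or (A := A) (B := B) (p := p) with ⟨h, -⟩ | ⟨w, -, -, h⟩
  · simp [h]
  · exact h

theorem neg_one_le_itr₂ [FiniteDimensional ℝ E] : -1 ≤ itr₂ A B p := by
  rcases itr₂_eq_neg_one_or (A := A) (B := B) (p := p) with ⟨-, h⟩ | ⟨w, ⟨-, h₁, h₂⟩, h, -⟩
  · exact h.ge
  · have := real_inner_le_norm w.1 w.2
    rw [h₁, h₂] at this
    linarith

theorem neg_inner_le_itr₂ [FiniteDimensional ℝ E] :
    ∀ w ∈ unitRelLimitingNormals A B p, -(inner ℝ w.1 w.2 : ℝ) ≤ itr₂ A B p := by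
  rcases itr₂_eq_neg_one_or (A := A) (B := B) (p := p) with ⟨h, -⟩ | ⟨w, -, -, h⟩
  · simp [h]
  · exact h

theorem pairDist_nonneg {F : Type*} [NormedAddCommGroup F] (w : F × F)
    (N : Set (F × F)) : 0 ≤ pairDist w N := by
  rw [pairDist]
  split_ifs
  · exact norm_nonneg _
  · exact Metric.infDist_nonneg

theorem pairDist_eq_zero_of_mem {F : Type*} [NormedAddCommGroup F] {w : F × F}
    {N : Set (F × F)} (h : w ∈ N) : pairDist w N = 0 := by
  rw [pairDist, if_neg (Set.nonempty_iff_ne_empty.1 ⟨w, h⟩)]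
  exact Metric.infDist_zero_of_mem (Set.mem_image_of_mem _ h)

theorem pairDist_pos {F : Type*} [NormedAddCommGroup F] {w : F × F} {N : Set (F × F)}
    (hN : IsClosed N) (h : w ∉ N) (h0 : w ≠ 0) :
    0 < pairDist w N := by
  rw [pairDist]
  split_ifs with he
  · exact norm_pos_iff.2 fun h => h0 (congrArg WithLp.ofLp h)
  · have hc : IsClosed (WithLp.toLp 2 '' N) := by
      have : WithLp.toLp 2 '' N = WithLp.ofLp ⁻¹' N := by
        ext y
        exact ⟨by rintro ⟨z, hz, rfl⟩; exact hz, fun hy => ⟨y.ofLp, hy, rfl⟩⟩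
      rw [this]
      exact hN.preimage (WithLp.prod_continuous_ofLp 2 F F)
    refine (hc.notMem_iff_infDist_pos ((Set.nonempty_iff_ne_empty.2 he).image _)).1 ?_
    rintro ⟨z, hz, hzw⟩
    exact h (WithLp.toLp_injective 2 hzw ▸ hz)

theorem continuous_pairDist {F : Type*} [NormedAddCommGroup F] (N : Set (F × F)) :
    Continuous fun w => pairDist w N := by
  by_cases he : N = ∅
  · simp only [pairDist, if_pos he]
    exact (WithLp.prod_continuous_toLp 2 F F).norm
  · simp only [pairDist, if_neg he]
    exact (Metric.continuous_infDist_pt _).comp (WithLp.prod_continuous_toLp 2 F F)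

theorem norm_toLp_antipodal {F : Type*} [NormedAddCommGroup F] {v : F} (hv : ‖v‖ = 1) :
    ‖WithLp.toLp 2 (v, -v)‖ = √2 := by
  rw [WithLp.prod_norm_eq_of_L2]
  simp [hv]
  norm_num

/-- Replacing the normals in an approximating sequence by `0`, with cosines `1` by convention,
gives an approximating sequence of the zero pair. -/
theorem zero_mem_relLimitingNormals (h : (relLimitingNormals A B p).Nonempty) :
    (0 : E × E) ∈ relLimitingNormals A B p := by
  obtain ⟨w, a, b, x, v₁, v₂, ha, hb, hxa, hxb, ta, tb, tx, -, -, -, -, tr, -, -⟩ := h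
  refine ⟨a, b, x, fun _ => 0, fun _ => 0, ha, hb, hxa, hxb, ta, tb, tx, tendsto_const_nhds,
    tendsto_const_nhds, fun k => zero_mem_frechetNormalCone A _,
    fun k => zero_mem_frechetNormalCone B _, tr, ?_, ?_⟩ <;>
  simp [cosine]

theorem pairDist_antipodal_le {v : E} (hv : ‖v‖ = 1) :
    pairDist (v, -v) (relLimitingNormals A B p) ≤ √2 := by
  rw [pairDist]
  split_ifs with he
  · exact (norm_toLp_antipodal hv).le
  · have h0 := zero_mem_relLimitingNormals (Set.nonempty_iff_ne_empty.2 he)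
    refine (Metric.infDist_le_dist_of_mem (Set.mem_image_of_mem (WithLp.toLp 2) h0)).trans ?_
    rw [WithLp.toLp_zero, dist_zero_right]
    exact (norm_toLp_antipodal hv).le

theorem sphere_image_bddBelow :
    BddBelow ((fun v : E => pairDist (v, -v) (relLimitingNormals A B p)) '' Metric.sphere 0 1) :=
  ⟨0, Set.forall_mem_image.2 fun _ _ => pairDist_nonneg _ _⟩

theorem itr₃_le_pairDist {v : E} (hv : ‖v‖ = 1) :
    itr₃ A B p ≤ pairDist (v, -v) (relLimitingNormals A B p) := by
  have hm : v ∈ Metric.sphere (0 : E) 1 := by simpa using hv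
  rw [itr₃, infOr, if_neg (Set.nonempty_iff_ne_empty.1 ⟨_, Set.mem_image_of_mem _ hm⟩)]
  exact csInf_le sphere_image_bddBelow (Set.mem_image_of_mem _ hm)

theorem le_itr₃ {α : ℝ} (hα : α ≤ √2)
    (h : ∀ v : E, ‖v‖ = 1 → α ≤ pairDist (v, -v) (relLimitingNormals A B p)) :
    α ≤ itr₃ A B p := by
  rw [itr₃, infOr]
  split_ifs with he
  · exact hα
  · exact le_csInf (Set.nonempty_iff_ne_empty.2 he)
      (Set.forall_mem_image.2 fun v hv => h v (by simpa using hv))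

theorem itr₃_le_sqrt_two : itr₃ A B p ≤ √2 := by
  rw [itr₃, infOr]
  split_ifs with he
  · exact le_rfl
  · obtain ⟨_, v, hv, rfl⟩ := Set.nonempty_iff_ne_empty.2 he
    exact csInf_le_of_le sphere_image_bddBelow (Set.mem_image_of_mem _ hv)
      (pairDist_antipodal_le (by simpa using hv))

/-! ### Absence of antipodal unit pairs -/

theorem exists_lt_norm_add [FiniteDimensional ℝ E]
    (h : ∀ w ∈ unitRelLimitingNormals A B p, w.1 + w.2 ≠ 0) :
    ∃ α ∈ Set.Ioo (0 : ℝ) 1, ∀ w ∈ unitRelLimitingNormals A B p, α < ‖w.1 + w.2‖ := by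
  rcases (unitRelLimitingNormals A B p).eq_empty_or_nonempty with he | hne
  · exact ⟨1 / 2, by norm_num, by simp [he]⟩
  · obtain ⟨w, hw, hmin⟩ := isCompact_unitRelLimitingNormals.exists_isMinOn hne
      (f := fun w : E × E => ‖w.1 + w.2‖) (by fun_prop)
    obtain ⟨α, h0, hα⟩ := exists_between (lt_min (norm_pos_iff.2 (h w hw)) one_pos)
    exact ⟨α, ⟨h0, hα.trans_le (min_le_right _ _)⟩, fun v hv =>
      (hα.trans_le (min_le_left _ _)).trans_le (hmin hv)⟩

theorem norm_sub_lt_two {u v : E} (hu : ‖u‖ = 1) (hv : ‖v‖ = 1) (h : u + v ≠ 0) :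
    ‖u - v‖ < 2 := by
  have hpos : 0 < ‖u + v‖ ^ 2 := by have := norm_pos_iff.2 h; positivity
  have h1 := norm_add_sq_of_unit hu hv
  have h2 := norm_sub_sq_of_unit hu hv
  nlinarith [norm_nonneg (u - v)]

theorem neg_inner_lt_one {u v : E} (hu : ‖u‖ = 1) (hv : ‖v‖ = 1) (h : u + v ≠ 0) :
    -(inner ℝ u v : ℝ) < 1 := by
  have hpos : 0 < ‖u + v‖ ^ 2 := by have := norm_pos_iff.2 h; positivity
  have h1 := norm_add_sq_of_unit hu hv
  linarith

theorem itr₁_lt_two [FiniteDimensional ℝ E]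
    (h : ∀ w ∈ unitRelLimitingNormals A B p, w.1 + w.2 ≠ 0) : itr₁ A B p < 2 := by
  rcases itr₁_eq_zero_or (A := A) (B := B) (p := p) with ⟨-, e⟩ | ⟨w, hw, e, -⟩
  · rw [e]
    exact two_pos
  · rw [← e]
    exact norm_sub_lt_two hw.2.1 hw.2.2 (h w hw)

theorem itr₂_lt_one [FiniteDimensional ℝ E]
    (h : ∀ w ∈ unitRelLimitingNormals A B p, w.1 + w.2 ≠ 0) : itr₂ A B p < 1 := by
  rcases itr₂_eq_neg_one_or (A := A) (B := B) (p := p) with ⟨-, e⟩ | ⟨w, hw, e, -⟩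
  · rw [e]
    norm_num
  · rw [← e]
    exact neg_inner_lt_one hw.2.1 hw.2.2 (h w hw)

theorem itr₃_pos [FiniteDimensional ℝ E]
    (h : ∀ w ∈ unitRelLimitingNormals A B p, w.1 + w.2 ≠ 0) : 0 < itr₃ A B p := by
  rcases (Metric.sphere (0 : E) 1).eq_empty_or_nonempty with he | hne
  · rw [itr₃, infOr, if_pos (by simp [he])]
    positivity
  · obtain ⟨v, hv, e, -⟩ := exists_eq_infOr_image (isCompact_sphere (0 : E) 1) hne
      (f := fun v : E => pairDist (v, -v) (relLimitingNormals A B p))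
      ((continuous_pairDist _).comp (by fun_prop)) (√2)
    have hv1 : ‖v‖ = 1 := by simpa using hv
    rw [itr₃, ← e]
    refine pairDist_pos isClosed_relLimitingNormals (fun hm => ?_) fun h0 => ?_
    · exact h (v, -v) ⟨hm, hv1, by simpa using hv1⟩ (by simp)
    · rw [(Prod.mk_eq_zero.1 h0).1, norm_zero] at hv1
      exact zero_ne_one hv1

theorem forall_relLimitingNormals_unit_iff {P : E × E → Prop} :
    (∀ w ∈ relLimitingNormals A B p, ‖w.1‖ = 1 → ‖w.2‖ = 1 → P w) ↔
      ∀ w ∈ unitRelLimitingNormals A B p, P w :=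
  ⟨fun h w hw => h w hw.1 hw.2.1 hw.2.2, fun h w hw h₁ h₂ => h w ⟨hw, h₁, h₂⟩⟩

end SetPair

/-! ### The equivalences -/

theorem mainTheorem11 {E : Type*} [NormedAddCommGroup E] [InnerProductSpace ℝ E]
    [FiniteDimensional ℝ E] (A B : Set E) (hA : IsClosed A) (hB : IsClosed B)
    (hAc : Convex ℝ A) (hBc : Convex ℝ B) (p : E) (hp : p ∈ A ∩ B) :
    List.TFAE [
      SetPair.IsSubtransversal A B p,
      ∃ α ∈ Set.Ioo (0 : ℝ) 1, ∀ w ∈ SetPair.relLimitingNormals A B p,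
        ‖w.1‖ = 1 → ‖w.2‖ = 1 → ‖w.1 + w.2‖ > α,
      SetPair.itr₁ A B p < 2,
      ∃ α < (2 : ℝ), ∀ w ∈ SetPair.relLimitingNormals A B p,
        ‖w.1‖ = 1 → ‖w.2‖ = 1 → ‖w.1 - w.2‖ < α,
      SetPair.itr₂ A B p < 1,
      ∃ α < (1 : ℝ), ∀ w ∈ SetPair.relLimitingNormals A B p,
        ‖w.1‖ = 1 → ‖w.2‖ = 1 → inner ℝ w.1 w.2 > -α,
      SetPair.itr₃ A B p > 0,
      ∃ α ∈ Set.Ioo (0 : ℝ) 1, ∀ v : E, ‖v‖ = 1 →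
        SetPair.pairDist (v, -v) (SetPair.relLimitingNormals A B p) > α,
      SetPair.itrHat₁ A B p > 0,
      ∃ α ∈ Set.Ioo (0 : ℝ) 1, SetPair.HatDistGt A B p α,
      ∃ α ∈ Set.Ioo (0 : ℝ) 1, SetPair.HatNormGt A B p α,
      SetPair.itrHat₂ A B p < 1,
      ∃ α ∈ Set.Ioo (0 : ℝ) 1, SetPair.HatInnerLt A B p α] ∧
    (SetPair.IsSubtransversal A B p →
      IsLUB {α : ℝ | α ∈ Set.Ioo (0 : ℝ) 2 ∧ ∀ w ∈ SetPair.relLimitingNormals A B p,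
        ‖w.1‖ = 1 → ‖w.2‖ = 1 → ‖w.1 + w.2‖ > α} (2 * SetPair.itr A B p) ∧
      IsGLB {α : ℝ | α ∈ Set.Ioo (0 : ℝ) 2 ∧ ∀ w ∈ SetPair.relLimitingNormals A B p,
        ‖w.1‖ = 1 → ‖w.2‖ = 1 → ‖w.1 - w.2‖ < α} (SetPair.itr₁ A B p) ∧
      IsGLB {α : ℝ | α ∈ Set.Ioo (-1 : ℝ) 1 ∧ ∀ w ∈ SetPair.relLimitingNormals A B p,
        ‖w.1‖ = 1 → ‖w.2‖ = 1 → inner ℝ w.1 w.2 > -α} (SetPair.itr₂ A B p) ∧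
      IsLUB {α : ℝ | α ∈ Set.Ioo (0 : ℝ) (√2) ∧ ∀ v : E, ‖v‖ = 1 →
        SetPair.pairDist (v, -v) (SetPair.relLimitingNormals A B p) > α} (SetPair.itr₃ A B p) ∧
      IsLUB {α : ℝ | α ∈ Set.Ioo (0 : ℝ) 1 ∧ SetPair.HatDistGt A B p α}
        (SetPair.itrHat₁ A B p) ∧
      IsLUB {α : ℝ | α ∈ Set.Ioo (0 : ℝ) 1 ∧ SetPair.HatNormGt A B p α}
        (SetPair.itrHat₁ A B p) ∧
      IsGLB {α : ℝ | α ∈ Set.Ioo (0 : ℝ) 1 ∧ SetPair.HatInnerLt A B p α}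
        (SetPair.itrHat₂ A B p)) := by
  -- Every item is equivalent to the absence of antipodal unit pairs of relative limiting normals.
  set U := SetPair.unitRelLimitingNormals A B p with hU
  simp only [gt_iff_lt,
    fun α : ℝ => SetPair.forall_relLimitingNormals_unit_iff (A := A) (B := B) (p := p)
      (P := fun w => α < ‖w.1 + w.2‖),
    fun α : ℝ => SetPair.forall_relLimitingNormals_unit_iff (A := A) (B := B) (p := p)
      (P := fun w => ‖w.1 - w.2‖ < α),
    fun α : ℝ => SetPair.forall_relLimitingNormals_unit_iff (A := A) (B := B) (p := p)
      (P := fun w => -α < inner ℝ w.1 w.2)]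
  have hnormQ : (∃ α ∈ Set.Ioo (0 : ℝ) 1, SetPair.HatNormGt A B p α) →
      ∀ w ∈ U, w.1 + w.2 ≠ 0 := fun ⟨α, hα, h⟩ => h.norm_add_ne_zero hα.1
  have hanti : ∀ w ∈ U, w.1 + w.2 = 0 → ‖w.1‖ = 1 ∧ w = (w.1, -w.1) := fun w hw h =>
    ⟨hw.2.1, Prod.ext rfl (eq_neg_of_add_eq_zero_right h)⟩
  have tfae : List.TFAE [
      SetPair.IsSubtransversal A B p,
      ∃ α ∈ Set.Ioo (0 : ℝ) 1, ∀ w ∈ U, α < ‖w.1 + w.2‖,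
      SetPair.itr₁ A B p < 2,
      ∃ α < (2 : ℝ), ∀ w ∈ U, ‖w.1 - w.2‖ < α,
      SetPair.itr₂ A B p < 1,
      ∃ α < (1 : ℝ), ∀ w ∈ U, -α < inner ℝ w.1 w.2,
      0 < SetPair.itr₃ A B p,
      ∃ α ∈ Set.Ioo (0 : ℝ) 1, ∀ v : E, ‖v‖ = 1 →
        α < SetPair.pairDist (v, -v) (SetPair.relLimitingNormals A B p),
      0 < SetPair.itrHat₁ A B p,
      ∃ α ∈ Set.Ioo (0 : ℝ) 1, SetPair.HatDistGt A B p α,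
      ∃ α ∈ Set.Ioo (0 : ℝ) 1, SetPair.HatNormGt A B p α,
      SetPair.itrHat₂ A B p < 1,
      ∃ α ∈ Set.Ioo (0 : ℝ) 1, SetPair.HatInnerLt A B p α,
      ∀ w ∈ U, w.1 + w.2 ≠ 0] := by
    tfae_have 1 → 11 := fun h => h.exists_hatNormGt hA hB hAc hBc hp
    tfae_have 11 → 14 := hnormQ
    tfae_have 14 → 2 := SetPair.exists_lt_norm_add
    tfae_have 2 → 13 := fun ⟨α, hα, h⟩ => SetPair.exists_hatInnerLt_of_forall_norm_add hα.1 h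
    tfae_have 13 → 11 := fun ⟨α, hα, h⟩ =>
      ⟨(1 - α) / 2, ⟨by linarith [hα.2], by linarith [hα.1]⟩, h.hatNormGt hα⟩
    tfae_have 11 ↔ 10 := by simp only [SetPair.hatNormGt_iff_hatDistGt hAc hBc]
    tfae_have 10 → 1 := fun ⟨α, hα, h⟩ => h.isSubtransversal hA hB hAc hBc hp hα.1
    tfae_have 14 → 3 := SetPair.itr₁_lt_two
    tfae_have 3 → 4 := fun h => by
      obtain ⟨α, h1, h2⟩ := exists_between h
      exact ⟨α, h2, fun w hw => (SetPair.norm_sub_le_itr₁ w hw).trans_lt h1⟩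
    tfae_have 4 → 14 := by
      rintro ⟨α, hα, h⟩ w hw h0
      have hlt := h w hw
      obtain ⟨h1, e⟩ := hanti w hw h0
      rw [e] at hlt
      dsimp only at hlt
      rw [sub_neg_eq_add, ← two_smul ℝ, norm_smul, h1, Real.norm_two] at hlt
      linarith
    tfae_have 14 → 5 := SetPair.itr₂_lt_one
    tfae_have 5 → 6 := fun h => by
      obtain ⟨α, h1, h2⟩ := exists_between h
      exact ⟨α, h2, fun w hw => neg_lt.1 ((SetPair.neg_inner_le_itr₂ w hw).trans_lt h1)⟩
    tfae_have 6 → 14 := by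
      rintro ⟨α, hα, h⟩ w hw h0
      have hlt := h w hw
      obtain ⟨h1, e⟩ := hanti w hw h0
      rw [e] at hlt
      dsimp only at hlt
      rw [inner_neg_right, real_inner_self_eq_norm_sq, h1] at hlt
      linarith
    tfae_have 14 → 7 := SetPair.itr₃_pos
    tfae_have 7 → 8 := fun h => by
      obtain ⟨α, h1, h2⟩ := exists_between (lt_min h one_pos)
      exact ⟨α, ⟨h1, h2.trans_le (min_le_right _ _)⟩, fun v hv =>
        (h2.trans_le (min_le_left _ _)).trans_le (SetPair.itr₃_le_pairDist hv)⟩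
    tfae_have 8 → 14 := by
      rintro ⟨α, hα, h⟩ w hw h0
      obtain ⟨h1, e⟩ := hanti w hw h0
      have hlt := h w.1 h1
      rw [← e, SetPair.pairDist_eq_zero_of_mem hw.1] at hlt
      exact hlt.not_gt hα.1
    tfae_have 9 → 10 := fun h => by
      obtain ⟨α, h1, h2⟩ := exists_between h
      exact ⟨α, ⟨h1, h2.trans_le SetPair.itrHat₁_le_one⟩, SetPair.hatDistGt_of_lt_itrHat₁ h2⟩
    tfae_have 10 → 9 := fun ⟨α, hα, h⟩ => hα.1.trans_le (h.le_itrHat₁ hα.2.le)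
    tfae_have 12 → 13 := fun h => by
      obtain ⟨α, h1, h2⟩ := exists_between h
      exact ⟨α, ⟨SetPair.itrHat₂_nonneg.trans_lt h1, h2⟩, SetPair.hatInnerLt_of_itrHat₂_lt h1⟩
    tfae_have 13 → 12 := fun ⟨α, hα, h⟩ => (h.itrHat₂_le hα.1.le).trans_lt hα.2
    tfae_finish
  refine ⟨fun i hi j hj => tfae i (List.mem_append_left [_] hi) j (List.mem_append_left [_] hj),
    fun hsub => ⟨?_, ?_, ?_, ?_, ?_, ?_, ?_⟩⟩
  · obtain ⟨α, hα, h⟩ := (tfae.out 0 1).1 hsub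
    have hpos : 0 < 2 * SetPair.itr A B p :=
      hα.1.trans_le (SetPair.le_two_mul_itr (by linarith [hα.2]) h)
    have hone := SetPair.itr_le_one (A := A) (B := B) (p := p)
    refine SetPair.isLUB_of_forall_Ioo hpos (fun β hβ => ⟨⟨hβ.1, by linarith [hβ.2]⟩,
      fun w hw => ?_⟩)
      fun β hβ => SetPair.le_two_mul_itr hβ.1.2.le hβ.2
    have := SetPair.two_mul_lt_norm_add_of_lt_itr (α := β / 2) (by linarith [hβ.2]) w hw
    linarith
  · refine SetPair.isGLB_of_forall_Ioo ((tfae.out 0 2).1 hsub)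
      (fun β hβ => ⟨⟨SetPair.itr₁_nonneg.trans_lt hβ.1, hβ.2⟩,
        fun w hw => (SetPair.norm_sub_le_itr₁ w hw).trans_lt hβ.1⟩) fun β hβ => ?_
    rcases SetPair.itr₁_eq_zero_or (A := A) (B := B) (p := p) with ⟨-, e⟩ | ⟨w, hw, e, -⟩
    · exact e.trans_le hβ.1.1.le
    · exact e ▸ (hβ.2 w hw).le
  · refine SetPair.isGLB_of_forall_Ioo ((tfae.out 0 4).1 hsub)
      (fun β hβ => ⟨⟨SetPair.neg_one_le_itr₂.trans_lt hβ.1, hβ.2⟩,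
        fun w hw => neg_lt.1 ((SetPair.neg_inner_le_itr₂ w hw).trans_lt hβ.1)⟩) fun β hβ => ?_
    rcases SetPair.itr₂_eq_neg_one_or (A := A) (B := B) (p := p) with ⟨-, e⟩ | ⟨w, hw, e, -⟩
    · exact e.trans_le hβ.1.1.le
    · exact e ▸ (neg_lt.1 (hβ.2 w hw)).le
  · exact SetPair.isLUB_of_forall_Ioo ((tfae.out 0 6).1 hsub)
      (fun β hβ => ⟨⟨hβ.1, hβ.2.trans_le SetPair.itr₃_le_sqrt_two⟩,
        fun v hv => hβ.2.trans_le (SetPair.itr₃_le_pairDist hv)⟩)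
      fun β hβ => SetPair.le_itr₃ hβ.1.2.le fun v hv => (hβ.2 v hv).le
  · exact SetPair.isLUB_of_forall_Ioo ((tfae.out 0 8).1 hsub)
      (fun β hβ => ⟨⟨hβ.1, hβ.2.trans_le SetPair.itrHat₁_le_one⟩,
        SetPair.hatDistGt_of_lt_itrHat₁ hβ.2⟩) fun β hβ => hβ.2.le_itrHat₁ hβ.1.2.le
  · simp only [SetPair.hatNormGt_iff_hatDistGt hAc hBc]
    exact SetPair.isLUB_of_forall_Ioo ((tfae.out 0 8).1 hsub)
      (fun β hβ => ⟨⟨hβ.1, hβ.2.trans_le SetPair.itrHat₁_le_one⟩,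
        SetPair.hatDistGt_of_lt_itrHat₁ hβ.2⟩) fun β hβ => hβ.2.le_itrHat₁ hβ.1.2.le
  · exact SetPair.isGLB_of_forall_Ioo ((tfae.out 0 11).1 hsub)
      (fun β hβ => ⟨⟨SetPair.itrHat₂_nonneg.trans_lt hβ.1, hβ.2⟩,
        SetPair.hatInnerLt_of_itrHat₂_lt hβ.1⟩) fun β hβ => hβ.2.itrHat₂_le hβ.1.1.le
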